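/- **Setting.** Let $M$ be a smooth paracompact manifold of dimension $n$, with induced coordinates $(x^\mu,y^a)$ on $TM$; all indices run over $1,\dots,n$, repeated indices (including the mesh indices $i,j$) are summed, $f_{,\mu}=\partial f/\partial x^\mu$ and $f_{;a}=\partial f/\partial y^a$. Let $N$ be a smooth nonlinear connection on $TM$ with coefficients $N^a_\mu(x,y)$, put $\delta_\mu=\partial/\partial x^\mu-N^a_\mu\,\partial/\partial y^a$, and let $R^a_{\mu\nu}=\delta_\nu N^a_\mu-\delta_\mu N^a_\nu$ be its curvature. Let $\lambda_i=\lambda_i^\alpha\delta_\alpha+\lambda_i^a\,\partial/\partial y^a$ $(i=1,\dots,n)$ be smooth vector fields on $TM$ whose horizontal parts are linearly independent and whose vertical parts are linearly independent (an extended absolute parallelism, EAP, space). $N$ and the $\lambda_i$ may be given on all of $TM$, or only on $TM$ without its null section; the statement then concerns the points where they are given. Let $(\lambda_{i\alpha})$ be the inverse matrix of $(\lambda_i^\alpha)$, $\lambda_i^\alpha\lambda_{i\beta}=\delta^\alpha_\beta$, and put $|\lambda|=\det(\lambda_{i\beta})$, $g_{\alpha\beta}=\lambda_{i\alpha}\lambda_{i\beta}$,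 $g^{\alpha\beta}=\lambda_i^\alpha\lambda_i^\beta$, $$\Gamma^\alpha_{\mu\nu}=\lambda_i^\alpha\,\delta_\nu\lambda_{i\mu},\qquad C^\alpha_{\mu a}=\lambda_i^\alpha\lambda_{i\mu;a},\qquad \Lambda^\alpha_{\mu\nu}=\Gamma^\alpha_{\mu\nu}-\Gamma^\alpha_{\nu\mu},\qquad C_\mu=\Lambda^\alpha_{\mu\alpha}.$$ Greek indices are raised and lowered with $g$; in particular $\Lambda_{\beta\mu\nu}=g_{\beta\epsilon}\Lambda^\epsilon_{\mu\nu}$ and $\Lambda_{\mu\nu}{}^{\epsilon}=g^{\epsilon\alpha}\Lambda_{\mu\nu\alpha}$. A bar denotes the horizontal covariant derivative, $V^\alpha{}_{|\mu}=\delta_\mu V^\alpha+V^\epsilon\Gamma^\alpha_{\epsilon\mu}$, $W_{\nu|\mu}=\delta_\mu W_\nu-W_\epsilon\Gamma^\epsilon_{\nu\mu}$, and similarly for tensors. Let $$H_{\mu\nu}=\Lambda^\alpha_{\epsilon\mu}\Lambda^\epsilon_{\alpha\nu}-C_\mu C_\nu,\qquad H=g^{\mu\nu}H_{\mu\nu},\qquad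 \mathcal H=|\lambda|\,g^{\mu\nu}H_{\mu\nu}.$$ **Theorem.** Assume that $N$ does not depend on the horizontal fundamental vector fields; that is, $\mathcal H$ is regarded as a function of the independent variables $\lambda_{j\beta},\lambda_{j\beta,\gamma},\lambda_{j\beta;a}$ in which $N^a_\mu$ is kept fixed under differentiation with respect to these variables. Let $$\frac{\delta\mathcal H}{\delta\lambda_{j\beta}}=\frac{\partial\mathcal H}{\partial\lambda_{j\beta}}-\frac{\partial}{\partial x^\gamma}\Big(\frac{\partial\mathcal H}{\partial\lambda_{j\beta,\gamma}}\Big)-\frac{\partial}{\partial y^a}\Big(\frac{\partial\mathcal H}{\partial\lambda_{j\beta;a}}\Big)$$ and $$\begin{aligned}E_{\mu\nu}={}&g_{\mu\nu}H-2H_{\mu\nu}-2C_\mu C_\nu-2g_{\mu\nu}\big(C^\epsilon{}_{|\epsilon}-C^\epsilon C_\epsilon\big)-2C^\epsilon\Lambda_{\mu\epsilon\nu}+2C_{\nu|\mu}-2g^{\epsilon\alpha}\Lambda_{\mu\nu\alpha|\epsilon}\\&-2N^a_{\epsilon;a}\big(\Lambda^\epsilon_{\nu\mu}-\Lambda_{\mu\nu}{}^{\epsilon}\big)+2g_{\mu\nu}C^\epsilon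 N^a_{\epsilon;a}-2C_\mu N^a_{\nu;a}\\&+2\big(C^\epsilon_{\mu a}R^a_{\nu\epsilon}+C^\epsilon_{\nu a}R^a_{\epsilon\mu}+C^\epsilon_{\epsilon a}R^a_{\mu\nu}\big).\end{aligned}$$ Then, in every chart of $M$ and at every point of the corresponding coordinate domain, $$E_{\mu\nu}=g_{\mu\beta}\,\frac{1}{|\lambda|}\,\frac{\delta\mathcal H}{\delta\lambda_{j\beta}}\,\lambda_{j\nu}\qquad\text{for all }\mu,\nu .$$ In particular, the Euler–Lagrange equations $\delta\mathcal H/\delta\lambda_{j\beta}=0$ (for all $j,\beta$) hold at that point if and only if $E_{\mu\nu}=0$ (for all $\mu,\nu$) there. -/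

import Mathlib

open scoped Manifold ContDiff

noncomputable section

namespace EAP

/-! ### Coordinates on the tangent bundle -/

/-- Coordinates `x` on the base manifold. -/
abbrev Coord (n : ℕ) := EuclideanSpace ℝ (Fin n)

/-- Coordinates `(x, y)` on the tangent bundle. -/
abbrev TCoord (n : ℕ) := Coord n × Coord n

/-- The `γ`-th coordinate vector. -/
def unitVec {n : ℕ} (γ : Fin n) : Coord n := EuclideanSpace.single γ (1 : ℝ)

/-- `∂f / ∂x^γ`. -/
def dX {n : ℕ} (γ : Fin n) (f : TCoord n → ℝ) (p : TCoord n) : ℝ :=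
  lineDeriv ℝ f p (unitVec γ, 0)

/-- `∂f / ∂y^a`, also written `f_{;a}`. -/
def dY {n : ℕ} (a : Fin n) (f : TCoord n → ℝ) (p : TCoord n) : ℝ :=
  lineDeriv ℝ f p (0, unitVec a)

section Bundle

variable {n : ℕ} {M : Type*} [TopologicalSpace M]

/-- The coordinate domain in `TM` belonging to the chart `e` of `M`: all of `π⁻¹(U)` when `slit` is
false, and `π⁻¹(U)` without the null section `y = 0` when `slit` is true. -/
def coordDomain (e : OpenPartialHomeomorph M (Coord n)) (slit : Prop) : Set (TCoord n) :=
  {p | p.1 ∈ e.target ∧ (slit → p.2 ≠ 0)}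

/-- `x' = x'(x)` from the chart `e` to the chart `e'`. -/
def transition (e e' : OpenPartialHomeomorph M (Coord n)) (x : Coord n) : Coord n :=
  e' (e.symm x)

/-- `p^{a'}_a = ∂x^{a'} / ∂x^a`. -/
def jac (e e' : OpenPartialHomeomorph M (Coord n)) (x : Coord n) (a' a : Fin n) : ℝ :=
  lineDeriv ℝ (fun z => transition e e' z a') x (unitVec a)

/-- `p^{a'}_{a α} = ∂p^{a'}_a / ∂x^α`. -/
def jac2 (e e' : OpenPartialHomeomorph M (Coord n)) (x : Coord n) (a' a α : Fin n) : ℝ :=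
  lineDeriv ℝ (fun z => jac e e' z a' a) x (unitVec α)

/-- The coordinate change on `TM`: `x' = x'(x)`, `y^{a'} = p^{a'}_a y^a`. -/
def tangentTransition (e e' : OpenPartialHomeomorph M (Coord n)) (p : TCoord n) : TCoord n :=
  (transition e e' p.1, WithLp.toLp 2 fun a' => ∑ a, jac e e' p.1 a' a * p.2 a)

/-- A nonlinear connection on `TM` (or on `TM` without its null section): smooth local coefficients
`N^a_α(x, y)`, written `coeff e (x, y) a α`, in every chart of the smooth manifold `M`, subject to
`N^{a'}_{α'} = p^{a'}_a p^α_{α'} N^a_α + p^{a'}_a p^a_{c'α'} y^{c'}`. -/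
structure NonlinearConnection (n : ℕ) (M : Type*) [TopologicalSpace M] [ChartedSpace (Coord n) M]
    (slit : Prop) where
  coeff : OpenPartialHomeomorph M (Coord n) → TCoord n → Fin n → Fin n → ℝ
  smooth : ∀ e ∈ IsManifold.maximalAtlas (𝓡 n) ∞ M, ∀ a α,
    ContDiffOn ℝ ∞ (fun p => coeff e p a α) (coordDomain e slit)
  transform : ∀ e ∈ IsManifold.maximalAtlas (𝓡 n) ∞ M, ∀ e' ∈ IsManifold.maximalAtlas (𝓡 n) ∞ M,
    ∀ p ∈ coordDomain e slit, e.symm p.1 ∈ e'.source → ∀ a' α',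
      coeff e' (tangentTransition e e' p) a' α' =
        (∑ a, ∑ α, jac e e' p.1 a' a * jac e' e (transition e e' p.1) α α' * coeff e p a α) +
        ∑ a, ∑ c', jac e e' p.1 a' a * jac2 e' e (transition e e' p.1) a c' α' *
          (tangentTransition e e' p).2 c'

/-- A `d`-vector field on `TM` (or on `TM` without its null section): smooth local components
`V^α(x, y)` with `V^{α'} = p^{α'}_α V^α`. In the adapted basis such a family of components is the
same thing as a horizontal vector field `V^α δ_α`, and also the same thing as a vertical vector
field `V^a ∂/∂y^a`. -/
structure DVectorField (n : ℕ) (M : Type*) [TopologicalSpace M] [ChartedSpace (Coord n) M]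
    (slit : Prop) where
  comp : OpenPartialHomeomorph M (Coord n) → TCoord n → Fin n → ℝ
  smooth : ∀ e ∈ IsManifold.maximalAtlas (𝓡 n) ∞ M, ∀ α,
    ContDiffOn ℝ ∞ (fun p => comp e p α) (coordDomain e slit)
  transform : ∀ e ∈ IsManifold.maximalAtlas (𝓡 n) ∞ M, ∀ e' ∈ IsManifold.maximalAtlas (𝓡 n) ∞ M,
    ∀ p ∈ coordDomain e slit, e.symm p.1 ∈ e'.source → ∀ α',
      comp e' (tangentTransition e e' p) α' = ∑ α, jac e e' p.1 α' α * comp e p α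

/-- An extended absolute parallelism space `(TM, λ)`: a nonlinear connection `N` and `n` vector
fields `λ_i = λ_i^α δ_α + λ_i^a ∂/∂y^a` on `TM`, given by their horizontal and vertical parts, such
that the horizontal parts are linearly independent and so are the vertical parts. -/
structure EAPSpace (n : ℕ) (M : Type*) [TopologicalSpace M] [ChartedSpace (Coord n) M]
    (slit : Prop) where
  N : NonlinearConnection n M slit
  hor : Fin n → DVectorField n M slit
  ver : Fin n → DVectorField n M slit
  hor_independent : ∀ e ∈ IsManifold.maximalAtlas (𝓡 n) ∞ M, ∀ p ∈ coordDomain e slit,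
    LinearIndependent ℝ (fun i => (hor i).comp e p)
  ver_independent : ∀ e ∈ IsManifold.maximalAtlas (𝓡 n) ∞ M, ∀ p ∈ coordDomain e slit,
    LinearIndependent ℝ (fun i => (ver i).comp e p)

variable [ChartedSpace (Coord n) M] {slit : Prop}

/-- The coefficients `N^a_μ(x, y)` in the chart `e`. -/
def EAPSpace.nCoeff (S : EAPSpace n M slit) (e : OpenPartialHomeomorph M (Coord n)) :
    TCoord n → Fin n → Fin n → ℝ :=
  S.N.coeff e

/-- The covariant components `λ_{iβ}` in the chart `e`, i.e. the inverse matrix of `(λ_i^α)`: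
`∑ i, λ_i^α λ_{iβ} = δ^α_β`. -/
def EAPSpace.hCov (S : EAPSpace n M slit) (e : OpenPartialHomeomorph M (Coord n)) :
    TCoord n → Fin n → Fin n → ℝ :=
  fun p i β => (Matrix.of fun i α => (S.hor i).comp e p α)⁻¹ β i

end Bundle

/-! ### The horizontal Lagrangian as a function of independent variables -/

variable {n : ℕ}

/-- The independent variables `λ_{iβ}` (`val i β`), `λ_{iβ,γ}` (`dx i β γ`) and `λ_{iβ;a}`
(`dy i β a`). -/
structure Jet (n : ℕ) where
  val : Fin n → Fin n → ℝ
  dx : Fin n → Fin n → Fin n → ℝ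
  dy : Fin n → Fin n → Fin n → ℝ

namespace Jet

/-- `λ_i^α`, the inverse matrix of `(λ_{iα})`. -/
def up (J : Jet n) (i α : Fin n) : ℝ := (Matrix.of J.val)⁻¹ α i

/-- `|λ| = det (λ_{iβ})`. -/
def detLam (J : Jet n) : ℝ := (Matrix.of J.val).det

/-- `g_{αβ} = λ_{iα} λ_{iβ}`. -/
def gDown (J : Jet n) (α β : Fin n) : ℝ := ∑ i, J.val i α * J.val i β

/-- `g^{αβ} = λ_i^α λ_i^β`. -/
def gUp (J : Jet n) (α β : Fin n) : ℝ := ∑ i, J.up i α * J.up i β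

/-- `Γ^α_{μν} = λ_i^α (δ_ν λ_{iμ})`, where `δ_ν λ_{iμ} = λ_{iμ,ν} - N^a_ν λ_{iμ;a}`. -/
def Gam (N : Fin n → Fin n → ℝ) (J : Jet n) (α μ ν : Fin n) : ℝ :=
  ∑ i, J.up i α * (J.dx i μ ν - ∑ a, N a ν * J.dy i μ a)

/-- `C^α_{μa} = λ_i^α λ_{iμ;a}`. -/
def vert (J : Jet n) (α μ a : Fin n) : ℝ := ∑ i, J.up i α * J.dy i μ a

/-- `Λ^α_{μν} = Γ^α_{μν} - Γ^α_{νμ}`. -/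
def Lam (N : Fin n → Fin n → ℝ) (J : Jet n) (α μ ν : Fin n) : ℝ :=
  J.Gam N α μ ν - J.Gam N α ν μ

/-- `C_μ = Λ^α_{μα}`. -/
def basic (N : Fin n → Fin n → ℝ) (J : Jet n) (μ : Fin n) : ℝ := ∑ α, J.Lam N α μ α

/-- `H_{μν} = Λ^α_{εμ} Λ^ε_{αν} - C_μ C_ν`. -/
def HTensor (N : Fin n → Fin n → ℝ) (J : Jet n) (μ ν : Fin n) : ℝ :=
  (∑ α, ∑ ε, J.Lam N α ε μ * J.Lam N ε α ν) - J.basic N μ * J.basic N ν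

/-- `H = g^{μν} H_{μν}`. -/
def HScalar (N : Fin n → Fin n → ℝ) (J : Jet n) : ℝ := ∑ μ, ∑ ν, J.gUp μ ν * J.HTensor N μ ν

/-- The horizontal Lagrangian `ℋ = |λ| g^{μν} H_{μν}`. The values `N^a_μ` of the nonlinear
connection enter as parameters which do not depend on the variables of the jet: this is the
assumption that `N` does not depend on the horizontal fundamental vector fields. -/
def lagrangian (N : Fin n → Fin n → ℝ) (J : Jet n) : ℝ := J.detLam * J.HScalar N

/-- `∂F / ∂λ_{jβ}`. -/
def partialVal (F : Jet n → ℝ) (J : Jet n) (j β : Fin n) : ℝ :=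
  lineDeriv ℝ (fun v => F ⟨v, J.dx, J.dy⟩) J.val (Pi.single j (Pi.single β 1))

/-- `∂F / ∂λ_{jβ,γ}`. -/
def partialDx (F : Jet n → ℝ) (J : Jet n) (j β γ : Fin n) : ℝ :=
  lineDeriv ℝ (fun v => F ⟨J.val, v, J.dy⟩) J.dx (Pi.single j (Pi.single β (Pi.single γ 1)))

/-- `∂F / ∂λ_{jβ;a}`. -/
def partialDy (F : Jet n → ℝ) (J : Jet n) (j β a : Fin n) : ℝ :=
  lineDeriv ℝ (fun v => F ⟨J.val, J.dx, v⟩) J.dy (Pi.single j (Pi.single β (Pi.single a 1)))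

end Jet

/-! ### Geometric objects of local fields

In this part `N p a μ` are the coefficients `N^a_μ` and `l p i β` are the components `λ_{iβ}` at the
point with coordinates `p = (x, y)`. -/

/-- The values of `λ_{iβ}`, `λ_{iβ,γ}` and `λ_{iβ;a}` at a point. -/
def jet (l : TCoord n → Fin n → Fin n → ℝ) (p : TCoord n) : Jet n where
  val := l p
  dx := fun i β γ => dX γ (fun z => l z i β) p
  dy := fun i β a => dY a (fun z => l z i β) p

/-- The Euler–Lagrange expression of the horizontal Lagrangian,
`δℋ/δλ_{jβ} = ∂ℋ/∂λ_{jβ} - ∂/∂x^γ (∂ℋ/∂λ_{jβ,γ}) - ∂/∂y^a (∂ℋ/∂λ_{jβ;a})`. -/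
def eulerLagrange (N l : TCoord n → Fin n → Fin n → ℝ) (p : TCoord n) (j β : Fin n) : ℝ :=
  Jet.partialVal (Jet.lagrangian (N p)) (jet l p) j β
    - ∑ γ, dX γ (fun z => Jet.partialDx (Jet.lagrangian (N z)) (jet l z) j β γ) p
    - ∑ a, dY a (fun z => Jet.partialDy (Jet.lagrangian (N z)) (jet l z) j β a) p

/-- `δ_μ f = ∂f/∂x^μ - N^a_μ ∂f/∂y^a`. -/
def delta (N : TCoord n → Fin n → Fin n → ℝ) (μ : Fin n) (f : TCoord n → ℝ) (p : TCoord n) : ℝ :=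
  dX μ f p - ∑ a, N p a μ * dY a f p

/-- The curvature of the nonlinear connection, `R^a_{μν} = δ_ν N^a_μ - δ_μ N^a_ν`. -/
def curvN (N : TCoord n → Fin n → Fin n → ℝ) (p : TCoord n) (a μ ν : Fin n) : ℝ :=
  delta N ν (fun z => N z a μ) p - delta N μ (fun z => N z a ν) p

/-- `N^a_{ε;a}`. -/
def divN (N : TCoord n → Fin n → Fin n → ℝ) (p : TCoord n) (ε : Fin n) : ℝ :=
  ∑ a, dY a (fun z => N z a ε) p

section Fields

variable (N l : TCoord n → Fin n → Fin n → ℝ)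

/-- `Γ^α_{μν}`, the horizontal coefficients of the canonical `d`-connection. -/
def Gam (p : TCoord n) (α μ ν : Fin n) : ℝ := (jet l p).Gam (N p) α μ ν

/-- The torsion `Λ^α_{μν}`. -/
def Lam (p : TCoord n) (α μ ν : Fin n) : ℝ := (jet l p).Lam (N p) α μ ν

/-- `Λ_{βμν} = g_{βε} Λ^ε_{μν}`. -/
def LamDown (p : TCoord n) (β μ ν : Fin n) : ℝ := ∑ ε, (jet l p).gDown β ε * Lam N l p ε μ ν

/-- `Λ_{μν}^ε = g^{εα} Λ_{μνα}`. -/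
def LamDownUp (p : TCoord n) (μ ν ε : Fin n) : ℝ := ∑ α, (jet l p).gUp ε α * LamDown N l p μ ν α

/-- The basic vector `C_μ`. -/
def CDown (p : TCoord n) (μ : Fin n) : ℝ := (jet l p).basic (N p) μ

/-- `C^ε = g^{εα} C_α`. -/
def CUp (p : TCoord n) (ε : Fin n) : ℝ := ∑ α, (jet l p).gUp ε α * CDown N l p α

/-- Horizontal covariant derivative of a vector, `V^α_{|μ} = δ_μ V^α + V^ε Γ^α_{εμ}`. -/
def covVec (V : TCoord n → Fin n → ℝ) (p : TCoord n) (α μ : Fin n) : ℝ :=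
  delta N μ (fun z => V z α) p + ∑ ε, V p ε * Gam N l p α ε μ

/-- Horizontal covariant derivative of a covector, `W_{ν|μ} = δ_μ W_ν - W_ε Γ^ε_{νμ}`. -/
def covCovec (W : TCoord n → Fin n → ℝ) (p : TCoord n) (ν μ : Fin n) : ℝ :=
  delta N μ (fun z => W z ν) p - ∑ ε, W p ε * Gam N l p ε ν μ

/-- Horizontal covariant derivative of a covariant tensor of rank three, `A_{μνα|ε}`. -/
def covCov3 (A : TCoord n → Fin n → Fin n → Fin n → ℝ) (p : TCoord n) (μ ν α ε : Fin n) : ℝ :=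
  delta N ε (fun z => A z μ ν α) p
    - ∑ κ, A p κ ν α * Gam N l p κ μ ε
    - ∑ κ, A p μ κ α * Gam N l p κ ν ε
    - ∑ κ, A p μ ν κ * Gam N l p κ α ε

/-- The cyclic sum over the lower indices `μ, ν, ε` of `C^ε_{μa} R^a_{νε}`, where the upper index
stays contracted with the lower `ε`:
`C^ε_{μa} R^a_{νε} + C^ε_{νa} R^a_{εμ} + C^ε_{εa} R^a_{μν}`. -/
def cyclicCR (p : TCoord n) (μ ν : Fin n) : ℝ :=
  ∑ ε, ∑ a, ((jet l p).vert ε μ a * curvN N p a ν ε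
    + (jet l p).vert ε ν a * curvN N p a ε μ
    + (jet l p).vert ε ε a * curvN N p a μ ν)

/-- The tensor `E_{μν}` of the horizontal unified field equations. -/
def fieldE (p : TCoord n) (μ ν : Fin n) : ℝ :=
  (jet l p).gDown μ ν * (jet l p).HScalar (N p)
    - 2 * (jet l p).HTensor (N p) μ ν
    - 2 * (CDown N l p μ * CDown N l p ν)
    - 2 * (jet l p).gDown μ ν *
        ((∑ ε, covVec N l (CUp N l) p ε ε) - ∑ ε, CUp N l p ε * CDown N l p ε)
    - 2 * (∑ ε, CUp N l p ε * LamDown N l p μ ε ν)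
    + 2 * covCovec N l (CDown N l) p ν μ
    - 2 * (∑ ε, ∑ α, (jet l p).gUp ε α * covCov3 N l (LamDown N l) p μ ν α ε)
    - 2 * (∑ ε, divN N p ε * (Lam N l p ε ν μ - LamDownUp N l p μ ν ε))
    + 2 * (jet l p).gDown μ ν * (∑ ε, CUp N l p ε * divN N p ε)
    - 2 * (CDown N l p μ * divN N p ν)
    + 2 * cyclicCR N l p μ ν

end Fields

end EAP

end

noncomputable section

namespace EAP

/-! ### Frame algebra -/

section FrameAlgebra

variable {n : ℕ}

/-! The frame `λ_i` is orthonormal for `g` and parallel for `Γ`, so everything can be compared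
through frame components. Let `T^i_{ab}` be the frame components of the curl `δ_ν λ_{iμ} - δ_μ
λ_{iν}`. Raising and lowering indices leaves frame components unchanged, a horizontal covariant
derivative becomes `δ_μ` of the components (`covCovec_eq`, `covVec_eq`, `covCov3_eq`), and `ℋ` is
`|λ|` times a quadratic polynomial in `T` with constant coefficients (`Jet.HScalar_eq`).

Variational side: the derivatives of `|λ|`, of the dual frame and of `T` give the partial
derivatives of `ℋ`. The derivatives of `λ` enter only through `δ_γ λ_{jβ}`, hence `∂ℋ/∂λ_{jβ;a} =
-N^a_γ ∂ℋ/∂λ_{jβ,γ}`. The two divergences therefore merge into `δ_γ` of the momentum, leaving a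
multiple of `N^a_{γ;a}` (`eulerLagrange_eq`). Contracting with `λ_{aβ}` expresses the result in `T`,
its frame derivatives and the frame components of `N^a_{γ;a}` (`sum_coframe_mul_eulerLagrange`).

Tensor side: only the curvature terms of `E_{μν}` are not yet of this kind. Since `[δ_κ, δ_ν]` is
vertical with coefficients given by `R`, the cyclic derivative of the curl of `λ_i` produces exactly
those terms. Expanding the same derivative in the frame gives a contracted Bianchi identity
(`cyclicCR_eq`). With it both sides have the same frame components (`fieldE_eq_pull`). The
equivalence of the two systems follows because the frame is invertible. -/

/-- The frame `λ_i^α` dual to the coframe `λ_{iα}`. -/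
def dualFrame (l : Fin n → Fin n → ℝ) (i α : Fin n) : ℝ := (Matrix.of l)⁻¹ α i

theorem sum_dualFrame_mul {l : Fin n → Fin n → ℝ} (hl : (Matrix.of l).det ≠ 0) (α β : Fin n) :
    ∑ i, dualFrame l i α * l i β = if α = β then 1 else 0 := by
  have h := Matrix.nonsing_inv_mul (Matrix.of l) (isUnit_iff_ne_zero.2 hl)
  have h2 := congrFun (congrFun h α) β
  simpa [Matrix.mul_apply, Matrix.one_apply, dualFrame] using h2

theorem sum_mul_dualFrame {l : Fin n → Fin n → ℝ} (hl : (Matrix.of l).det ≠ 0) (i j : Fin n) :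
    ∑ α, l i α * dualFrame l j α = if i = j then 1 else 0 := by
  have h := Matrix.mul_nonsing_inv (Matrix.of l) (isUnit_iff_ne_zero.2 hl)
  have h2 := congrFun (congrFun h i) j
  simpa [Matrix.mul_apply, Matrix.one_apply, dualFrame] using h2

/-- Contraction of a covector and a vector, in terms of their frame components. -/
theorem sum_pairing {l : Fin n → Fin n → ℝ} (hl : (Matrix.of l).det ≠ 0) (F G : Fin n → ℝ) :
    ∑ α, (∑ i, l i α * F i) * (∑ j, dualFrame l j α * G j) = ∑ i, F i * G i := by
  calc ∑ α, (∑ i, l i α * F i) * (∑ j, dualFrame l j α * G j)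
      = ∑ α, ∑ i, ∑ j, (F i * G j) * (l i α * dualFrame l j α) := by
        refine Finset.sum_congr rfl fun α _ => ?_
        rw [Finset.sum_mul_sum]
        exact Finset.sum_congr rfl fun i _ => Finset.sum_congr rfl fun j _ => by ring
    _ = ∑ i, ∑ j, (F i * G j) * ∑ α, l i α * dualFrame l j α := by
        rw [Finset.sum_comm]
        refine Finset.sum_congr rfl fun i _ => ?_
        rw [Finset.sum_comm]
        exact Finset.sum_congr rfl fun j _ => by rw [Finset.mul_sum]
    _ = ∑ i, F i * G i := by
        simp [sum_mul_dualFrame hl]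

theorem sum_pairing' {l : Fin n → Fin n → ℝ} (hl : (Matrix.of l).det ≠ 0) (F G : Fin n → ℝ) :
    ∑ α, (∑ j, dualFrame l j α * G j) * (∑ i, l i α * F i) = ∑ i, G i * F i := by
  simpa only [mul_comm] using sum_pairing hl F G

theorem sum_frame_expand {l : Fin n → Fin n → ℝ} (hl : (Matrix.of l).det ≠ 0) (f : Fin n → ℝ)
    (μ : Fin n) : ∑ a, l a μ * ∑ ρ, dualFrame l a ρ * f ρ = f μ := by
  simp_rw [Finset.mul_sum]
  rw [Finset.sum_comm]
  have : ∀ ρ, ∑ a, l a μ * (dualFrame l a ρ * f ρ) = (if ρ = μ then 1 else 0) * f ρ := fun ρ => by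
    rw [← sum_dualFrame_mul hl, Finset.sum_mul]
    exact Finset.sum_congr rfl fun a _ => by ring
  simp [this]

/-- The contraction of a covector with `λ_a`. -/
theorem sum_dualFrame_coframe {l : Fin n → Fin n → ℝ} (hl : (Matrix.of l).det ≠ 0) (F : Fin n → ℝ)
    (a : Fin n) : ∑ ρ, dualFrame l a ρ * ∑ b, l b ρ * F b = F a := by
  simp_rw [Finset.mul_sum]
  rw [Finset.sum_comm]
  have : ∀ b, ∑ ρ, dualFrame l a ρ * (l b ρ * F b) = (if b = a then 1 else 0) * F b := fun b => by
    rw [← sum_mul_dualFrame hl, Finset.sum_mul]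
    exact Finset.sum_congr rfl fun a _ => by ring
  simp [this]

theorem sum_coframe_dualFrame {l : Fin n → Fin n → ℝ} (hl : (Matrix.of l).det ≠ 0) (F : Fin n → ℝ)
    (a : Fin n) : ∑ ρ, l a ρ * ∑ b, dualFrame l b ρ * F b = F a := by
  simp_rw [Finset.mul_sum]
  rw [Finset.sum_comm]
  have : ∀ b, ∑ ρ, l a ρ * (dualFrame l b ρ * F b) = (if a = b then 1 else 0) * F b := fun b => by
    rw [← sum_mul_dualFrame hl, Finset.sum_mul]
    exact Finset.sum_congr rfl fun a _ => by ring
  simp [this]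

theorem sum_frame_expand_up {l : Fin n → Fin n → ℝ} (hl : (Matrix.of l).det ≠ 0) (f : Fin n → ℝ)
    (μ : Fin n) : ∑ a, dualFrame l a μ * ∑ ρ, l a ρ * f ρ = f μ := by
  simp_rw [Finset.mul_sum]
  rw [Finset.sum_comm]
  have : ∀ ρ, ∑ a, dualFrame l a μ * (l a ρ * f ρ) = (if μ = ρ then 1 else 0) * f ρ := fun ρ => by
    rw [← sum_dualFrame_mul hl, Finset.sum_mul]
    exact Finset.sum_congr rfl fun a _ => by ring
  simp [this]

/-- The covariant tensor of rank two with frame components `X a b`. -/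
def pull (l : Fin n → Fin n → ℝ) (X : Fin n → Fin n → ℝ) (μ ν : Fin n) : ℝ :=
  ∑ a, l a μ * ∑ b, l b ν * X a b

/-- The frame components of a covariant tensor of rank two. -/
def frameComp (l : Fin n → Fin n → ℝ) (W : Fin n → Fin n → ℝ) (a b : Fin n) : ℝ :=
  ∑ μ, dualFrame l a μ * ∑ ν, dualFrame l b ν * W μ ν

theorem pull_frameComp {l : Fin n → Fin n → ℝ} (hl : (Matrix.of l).det ≠ 0)
    (W : Fin n → Fin n → ℝ) (μ ν : Fin n) : pull l (frameComp l W) μ ν = W μ ν := by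
  unfold pull frameComp
  have : ∀ a, ∑ b, l b ν * ∑ ρ, dualFrame l a ρ * ∑ σ, dualFrame l b σ * W ρ σ
      = ∑ ρ, dualFrame l a ρ * W ρ ν := fun a => by
    simp_rw [Finset.mul_sum]
    rw [Finset.sum_comm]
    refine Finset.sum_congr rfl fun ρ _ => ?_
    rw [← sum_frame_expand hl (W ρ) ν, Finset.mul_sum]
    exact Finset.sum_congr rfl fun b _ => by
      simp_rw [Finset.mul_sum]
      exact Finset.sum_congr rfl fun b _ => by ring
  simp_rw [this]
  exact sum_frame_expand hl (fun ρ => W ρ ν) μ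

theorem frameComp_pull {l : Fin n → Fin n → ℝ} (hl : (Matrix.of l).det ≠ 0)
    (X : Fin n → Fin n → ℝ) (a b : Fin n) : frameComp l (pull l X) a b = X a b := by
  unfold pull frameComp
  have : ∀ μ, ∑ ν, dualFrame l b ν * ∑ c, l c μ * ∑ d, l d ν * X c d
      = ∑ c, l c μ * X c b := fun μ => by
    simp_rw [Finset.mul_sum]
    rw [Finset.sum_comm]
    refine Finset.sum_congr rfl fun c _ => ?_
    rw [← sum_dualFrame_coframe hl (X c) b, Finset.mul_sum]
    exact Finset.sum_congr rfl fun b _ => by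
      simp_rw [Finset.mul_sum]
      exact Finset.sum_congr rfl fun b _ => by ring
  simp_rw [this]
  exact sum_dualFrame_coframe hl (fun c => X c b) a

theorem pull_swap (l : Fin n → Fin n → ℝ) (X : Fin n → Fin n → ℝ) (μ ν : Fin n) :
    pull l X μ ν = pull l (fun a b => X b a) ν μ := by
  unfold pull
  simp_rw [Finset.mul_sum]
  rw [Finset.sum_comm]
  exact Finset.sum_congr rfl fun a _ => Finset.sum_congr rfl fun b _ => by ring

/-- Linearity of `pull`, here and below, serves to collect all terms of `E_{μν}` under a single
`pull`. -/
theorem pull_add (l : Fin n → Fin n → ℝ) (X Y : Fin n → Fin n → ℝ) (μ ν : Fin n) :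
    pull l X μ ν + pull l Y μ ν = pull l (fun a b => X a b + Y a b) μ ν := by
  simp [pull, mul_add, Finset.sum_add_distrib]

theorem pull_sub (l : Fin n → Fin n → ℝ) (X Y : Fin n → Fin n → ℝ) (μ ν : Fin n) :
    pull l X μ ν - pull l Y μ ν = pull l (fun a b => X a b - Y a b) μ ν := by
  simp [pull, mul_sub, Finset.sum_sub_distrib]

theorem mul_pull (l : Fin n → Fin n → ℝ) (k : ℝ) (X : Fin n → Fin n → ℝ) (μ ν : Fin n) :
    k * pull l X μ ν = pull l (fun a b => k * X a b) μ ν := by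
  simp only [pull, Finset.mul_sum]
  exact Finset.sum_congr rfl fun a _ => Finset.sum_congr rfl fun b _ => by ring

theorem sum_pull (l : Fin n → Fin n → ℝ) (X : Fin n → Fin n → Fin n → ℝ) (μ ν : Fin n) :
    ∑ i, pull l (X i) μ ν = pull l (fun a b => ∑ i, X i a b) μ ν := by
  simp only [pull, Finset.mul_sum]
  rw [Finset.sum_comm]
  refine Finset.sum_congr rfl fun a _ => ?_
  rw [Finset.sum_comm]

theorem pull_outer (l : Fin n → Fin n → ℝ) (V W : Fin n → ℝ) (μ ν : Fin n) :
    (∑ a, l a μ * V a) * (∑ b, l b ν * W b) = pull l (fun a b => V a * W b) μ ν := by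
  rw [Finset.sum_mul_sum]
  simp only [pull, Finset.mul_sum]
  exact Finset.sum_congr rfl fun a _ => Finset.sum_congr rfl fun b _ => by ring

/-- The frame is orthonormal for `g`: the metric has frame components `δ_{ab}`. -/
theorem pull_one (l : Fin n → Fin n → ℝ) (μ ν : Fin n) :
    ∑ i, l i μ * l i ν = pull l (fun a b => if a = b then 1 else 0) μ ν := by
  simp [pull]

/-- The frame components `T i a b` of the torsion of the coframe with derivatives `D i μ ν`. -/
def frameTorsion (l : Fin n → Fin n → ℝ) (D : Fin n → Fin n → Fin n → ℝ) (i a b : Fin n) : ℝ :=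
  frameComp l (fun μ ν => D i μ ν - D i ν μ) a b

/-- The trace `T^i_{ai}` of a torsion tensor. -/
def torsionTrace (T : Fin n → Fin n → Fin n → ℝ) (a : Fin n) : ℝ := ∑ i, T i a i

/-- The frame components of `H_{μν}`. -/
def frameH (T : Fin n → Fin n → Fin n → ℝ) (a b : Fin n) : ℝ :=
  (∑ c, ∑ e, T c e a * T e c b) - torsionTrace T a * torsionTrace T b

theorem frameComp_swap (l : Fin n → Fin n → ℝ) (W : Fin n → Fin n → ℝ) (a b : Fin n) :
    frameComp l W a b = frameComp l (fun μ ν => W ν μ) b a := by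
  unfold frameComp
  simp_rw [Finset.mul_sum]
  rw [Finset.sum_comm]
  exact Finset.sum_congr rfl fun a _ => Finset.sum_congr rfl fun b _ => by ring

theorem frameComp_sub (l : Fin n → Fin n → ℝ) (V W : Fin n → Fin n → ℝ) (a b : Fin n) :
    frameComp l (fun μ ν => V μ ν - W μ ν) a b = frameComp l V a b - frameComp l W a b := by
  simp [frameComp, mul_sub, Finset.sum_sub_distrib]

theorem frameTorsion_eq (l : Fin n → Fin n → ℝ) (D : Fin n → Fin n → Fin n → ℝ) (i a b : Fin n) :
    frameTorsion l D i a b = frameComp l (D i) a b - frameComp l (D i) b a := by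
  unfold frameTorsion
  rw [frameComp_sub, frameComp_swap l (fun μ ν => D i ν μ)]

theorem frameTorsion_antisymm (l : Fin n → Fin n → ℝ) (D : Fin n → Fin n → Fin n → ℝ)
    (i a b : Fin n) : frameTorsion l D i a b = - frameTorsion l D i b a := by
  rw [frameTorsion_eq, frameTorsion_eq]; ring

end FrameAlgebra

/-! ### Torsion, basic vector and horizontal Lagrangian in frame components. -/

namespace Jet

variable {n : ℕ} (N : Fin n → Fin n → ℝ) (J : Jet n)

/-- `δ_ν λ_{iμ}`. -/
def hor (i μ ν : Fin n) : ℝ := J.dx i μ ν - ∑ a, N a ν * J.dy i μ a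

/-- The frame components of the torsion `Λ`. -/
def tor (i a b : Fin n) : ℝ := frameTorsion J.val (J.hor N) i a b

theorem tor_antisymm (i a b : Fin n) : J.tor N i a b = - J.tor N i b a :=
  frameTorsion_antisymm _ _ _ _ _

variable {J}

/-- Antisymmetrizing `λ_i^α δ_ν λ_{iμ}` in `μ, ν` leaves `λ_i^α` times the curl of `λ_i`. -/
theorem Lam_eq (hJ : J.detLam ≠ 0) (α μ ν : Fin n) :
    J.Lam N α μ ν = ∑ i, dualFrame J.val i α * pull J.val (J.tor N i) μ ν := by
  have : ∀ i, pull J.val (J.tor N i) μ ν = J.hor N i μ ν - J.hor N i ν μ := fun i =>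
    pull_frameComp hJ _ μ ν
  simp_rw [this, mul_sub, Finset.sum_sub_distrib]
  rfl

theorem basic_eq (hJ : J.detLam ≠ 0) (μ : Fin n) :
    J.basic N μ = ∑ a, J.val a μ * torsionTrace (J.tor N) a := by
  unfold basic torsionTrace
  simp_rw [Lam_eq N hJ]
  have : ∀ i α, pull J.val (J.tor N i) μ α
      = ∑ b, J.val b α * ∑ a, J.val a μ * J.tor N i a b := fun i α => pull_swap _ _ _ _
  simp_rw [this]
  rw [Finset.sum_comm]
  have h2 : ∀ i, ∑ α, dualFrame J.val i α * ∑ b, J.val b α * ∑ a, J.val a μ * J.tor N i a b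
      = ∑ a, J.val a μ * J.tor N i a i := fun i =>
    sum_dualFrame_coframe hJ (fun b => ∑ a, J.val a μ * J.tor N i a b) i
  simp_rw [h2, Finset.mul_sum]
  rw [Finset.sum_comm]

theorem HTensor_eq (hJ : J.detLam ≠ 0) (μ ν : Fin n) :
    J.HTensor N μ ν = pull J.val (frameH (J.tor N)) μ ν := by
  unfold HTensor
  rw [basic_eq N hJ, basic_eq N hJ, pull_outer]
  have key : ∑ α, ∑ ε, J.Lam N α ε μ * J.Lam N ε α ν
      = pull J.val (fun a b => ∑ c, ∑ e, J.tor N c e a * J.tor N e c b) μ ν := by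
    -- `F` is the torsion with only its last index in coordinates. The two factors are expanded in
    -- different orders (`hL`, `hL'`), so that each contraction pairs a covector with a vector.
    let F : Fin n → Fin n → Fin n → ℝ := fun μ i a => ∑ b, J.val b μ * J.tor N i a b
    have hL : ∀ α ε μ, J.Lam N α ε μ
        = ∑ a, J.val a ε * ∑ i, dualFrame J.val i α * F μ i a := fun α ε μ => by
      rw [Lam_eq N hJ]
      simp only [pull, F]
      simp_rw [Finset.mul_sum]
      rw [Finset.sum_comm]
      exact Finset.sum_congr rfl fun a _ => Finset.sum_congr rfl fun b _ =>
        Finset.sum_congr rfl fun b _ => by ring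
    have hL' : ∀ α ε μ, J.Lam N α ε μ
        = ∑ i, dualFrame J.val i α * ∑ a, J.val a ε * F μ i a := fun α ε μ => by
      rw [Lam_eq N hJ]; rfl
    have h1 : ∀ α, ∑ ε, J.Lam N α ε μ * J.Lam N ε α ν
        = ∑ a, (∑ i, dualFrame J.val i α * F μ i a) * (∑ b, J.val b α * F ν a b) := fun α => by
      simp_rw [hL α _ μ, hL' _ α ν]
      exact sum_pairing hJ _ _
    simp_rw [h1]
    rw [Finset.sum_comm]
    have h2 : ∀ a, ∑ α, (∑ i, dualFrame J.val i α * F μ i a) * (∑ b, J.val b α * F ν a b)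
        = ∑ i, F μ i a * F ν a i := fun a => sum_pairing' hJ _ _
    simp_rw [h2, F, pull_outer]
    simp_rw [sum_pull]
    congr 1; ext a b
    rw [Finset.sum_comm]
  rw [key, pull_sub]
  rfl

/-- By orthonormality the `g`-trace is the plain trace of the frame components. Thus `H` depends on
the jet only through the frame torsion. -/
theorem HScalar_eq (hJ : J.detLam ≠ 0) : J.HScalar N = ∑ a, frameH (J.tor N) a a := by
  unfold HScalar gUp
  have h1 : ∀ μ ν, J.HTensor N μ ν
      = ∑ b, J.val b ν * ∑ a, J.val a μ * frameH (J.tor N) a b := fun μ ν => by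
    rw [HTensor_eq N hJ, pull_swap]; rfl
  have h2 : ∀ μ, ∑ ν, (∑ i, J.up i μ * J.up i ν) * J.HTensor N μ ν
      = ∑ i, J.up i μ * ∑ a, J.val a μ * frameH (J.tor N) a i := fun μ => by
    simp_rw [h1 μ]
    have := sum_pairing' hJ (fun b => ∑ a, J.val a μ * frameH (J.tor N) a b) (fun i => J.up i μ)
    rw [← this]
    refine Finset.sum_congr rfl fun ν _ => ?_
    congr 1
    exact Finset.sum_congr rfl fun i _ => mul_comm _ _
  simp_rw [h2]
  rw [Finset.sum_comm]
  exact Finset.sum_congr rfl fun i _ =>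
    sum_dualFrame_coframe hJ (fun a => frameH (J.tor N) a i) i

/-- Lowering an index replaces the frame by the coframe and keeps the components; `sum_gUp_mul` is
the converse. -/
theorem sum_gDown_mul (hJ : J.detLam ≠ 0) (β : Fin n) (G : Fin n → ℝ) :
    ∑ ε, J.gDown β ε * ∑ i, dualFrame J.val i ε * G i = ∑ i, J.val i β * G i := by
  rw [← sum_pairing hJ (fun i => J.val i β) G]
  refine Finset.sum_congr rfl fun ν _ => ?_
  congr 1
  exact Finset.sum_congr rfl fun i _ => mul_comm _ _

theorem sum_gUp_mul (hJ : J.detLam ≠ 0) (β : Fin n) (G : Fin n → ℝ) :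
    ∑ ε, J.gUp β ε * ∑ i, J.val i ε * G i = ∑ i, dualFrame J.val i β * G i := by
  rw [← sum_pairing' hJ G (fun i => dualFrame J.val i β)]
  refine Finset.sum_congr rfl fun ν _ => ?_
  congr 1
  exact Finset.sum_congr rfl fun i _ => mul_comm _ _

end Jet
/-! ### Variation of the coframe -/

section Variation

variable {n : ℕ}

theorem contDiff_det :
    ContDiff ℝ ∞ (fun l : Fin n → Fin n → ℝ => (Matrix.of l).det) := by
  simp only [Matrix.det_apply, Matrix.of_apply]
  refine ContDiff.sum fun σ _ => ContDiff.const_smul _ (contDiff_prod fun i _ => ?_)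
  exact contDiff_apply_apply ℝ ℝ _ _

/-- By Cramer's rule an entry of the inverse is a quotient of two determinants, hence smooth where
the denominator does not vanish. -/
theorem contDiffAt_dualFrame {l : Fin n → Fin n → ℝ} (hl : (Matrix.of l).det ≠ 0) (i α : Fin n) :
    ContDiffAt ℝ ∞ (fun l : Fin n → Fin n → ℝ => dualFrame l i α) l := by
  have h : (fun l : Fin n → Fin n → ℝ => dualFrame l i α) = fun l =>
      (Matrix.of l).det⁻¹ * (Matrix.of (Function.update l i (Pi.single α 1))).det := by
    ext l
    rw [dualFrame, Matrix.inv_def, Matrix.smul_apply, Matrix.adjugate_apply, Ring.inverse_eq_inv']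
    rfl
  rw [h]
  refine (contDiff_det.contDiffAt.inv hl).mul (ContDiff.contDiffAt ?_)
  refine contDiff_det.comp (contDiff_pi.2 fun k => ?_)
  by_cases hk : k = i
  · subst hk; simpa using contDiff_const
  · simpa [Function.update_of_ne hk] using contDiff_apply ℝ (Fin n → ℝ) k

variable {l : ℝ → Fin n → Fin n → ℝ} {l' : Fin n → Fin n → ℝ} {t : ℝ}

/-- Jacobi's formula. The differentiated Leibniz expansion, grouped by columns, is a sum of
determinants with one column replaced by its derivative, which the adjugate evaluates. -/
theorem hasDerivAt_det (hl : ∀ i α, HasDerivAt (fun s => l s i α) (l' i α) t)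
    (h0 : (Matrix.of (l t)).det ≠ 0) :
    HasDerivAt (fun s => (Matrix.of (l s)).det)
      ((Matrix.of (l t)).det * ∑ i, ∑ α, dualFrame (l t) i α * l' i α) t := by
  have h1 : HasDerivAt (fun s => (Matrix.of (l s)).det)
      (∑ σ : Equiv.Perm (Fin n), Equiv.Perm.sign σ •
        ∑ i, (∏ j ∈ Finset.univ.erase i, l t (σ j) j) • l' (σ i) i) t := by
    simp only [Matrix.det_apply, Matrix.of_apply]
    refine HasDerivAt.fun_sum fun σ _ => HasDerivAt.const_smul _ ?_
    exact HasDerivAt.fun_finsetProd fun i _ => hl _ _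
  refine h1.congr_deriv ?_
  have h2 : ∀ i, ∑ σ : Equiv.Perm (Fin n), Equiv.Perm.sign σ •
      (∏ j ∈ Finset.univ.erase i, l t (σ j) j) • l' (σ i) i
      = ((Matrix.of (l t)).updateCol i fun k => l' k i).det := fun i => by
    rw [Matrix.det_apply]
    refine Finset.sum_congr rfl fun σ _ => ?_
    congr 1
    rw [← Finset.prod_erase_mul _ _ (Finset.mem_univ i), smul_eq_mul]
    congr 1
    · exact Finset.prod_congr rfl fun j hj => by
        rw [Matrix.updateCol_ne (Finset.ne_of_mem_erase hj)]; rfl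
    · simp
  simp only [Finset.smul_sum]
  rw [Finset.sum_comm]
  simp_rw [h2, ← Matrix.cramer_apply, Matrix.cramer_eq_adjugate_mulVec]
  simp only [Matrix.mulVec, dotProduct]
  rw [Finset.sum_comm, Finset.mul_sum]
  refine Finset.sum_congr rfl fun i _ => ?_
  rw [Finset.mul_sum]
  refine Finset.sum_congr rfl fun α _ => ?_
  rw [dualFrame, Matrix.inv_def, Matrix.smul_apply, Ring.inverse_eq_inv', smul_eq_mul]
  field_simp

/-- The derivative of the dual frame: `δλ_i^α = -(λ_i^β δλ_{cβ}) λ_c^α`. -/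
theorem hasDerivAt_dualFrame (hl : ∀ i α, HasDerivAt (fun s => l s i α) (l' i α) t)
    (h0 : (Matrix.of (l t)).det ≠ 0) (i α : Fin n) :
    HasDerivAt (fun s => dualFrame (l s) i α)
      (-∑ c, (∑ β, dualFrame (l t) i β * l' c β) * dualFrame (l t) c α) t := by
  have hd : HasDerivAt l l' t := hasDerivAt_pi.2 fun i => hasDerivAt_pi.2 fun α => hl i α
  have hu : ∀ ρ, HasDerivAt (fun s => dualFrame (l s) i ρ)
      (deriv (fun s => dualFrame (l s) i ρ) t) t := fun ρ => by
    refine DifferentiableAt.hasDerivAt ?_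
    exact ((contDiffAt_dualFrame h0 i ρ).differentiableAt (by simp)).comp t hd.differentiableAt
  set u' : Fin n → ℝ := fun ρ => deriv (fun s => dualFrame (l s) i ρ) t with hu'
  have hev : ∀ᶠ s in nhds t, (Matrix.of (l s)).det ≠ 0 :=
    ((contDiff_det.continuous.continuousAt.comp hd.continuousAt).eventually_ne h0)
  -- Differentiability is already known, so differentiating the duality relation determines the
  -- derivative. That relation holds near `t`, where the determinant stays nonzero.
  have hz : ∀ c, ∑ ρ, l t c ρ * u' ρ = -∑ β, dualFrame (l t) i β * l' c β := fun c => by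
    have h1 : HasDerivAt (fun s => ∑ ρ, l s c ρ * dualFrame (l s) i ρ)
        (∑ ρ, (l' c ρ * dualFrame (l t) i ρ + l t c ρ * u' ρ)) t :=
      HasDerivAt.fun_sum fun ρ _ => (hl c ρ).mul (hu ρ)
    have h2 : HasDerivAt (fun s => ∑ ρ, l s c ρ * dualFrame (l s) i ρ) 0 t := by
      refine (hasDerivAt_const t (if c = i then (1 : ℝ) else 0)).congr_of_eventuallyEq ?_
      filter_upwards [hev] with s hs using sum_mul_dualFrame hs c i
    have h3 := h1.unique h2
    rw [Finset.sum_add_distrib] at h3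
    rw [eq_neg_iff_add_eq_zero, ← h3, add_comm]
    congr 1
    exact Finset.sum_congr rfl fun β _ => mul_comm _ _
  refine (hu α).congr_deriv ?_
  change u' α = _
  rw [← sum_frame_expand_up h0 u' α]
  simp_rw [hz]
  rw [← Finset.sum_neg_distrib]
  exact Finset.sum_congr rfl fun c _ => by ring

/-- The derivative of the frame components of a covariant tensor of rank two. -/
theorem hasDerivAt_frameComp {W : ℝ → Fin n → Fin n → ℝ} {W' : Fin n → Fin n → ℝ}
    (hl : ∀ i α, HasDerivAt (fun s => l s i α) (l' i α) t)
    (h0 : (Matrix.of (l t)).det ≠ 0)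
    (hW : ∀ μ ν, HasDerivAt (fun s => W s μ ν) (W' μ ν) t) (a b : Fin n) :
    HasDerivAt (fun s => frameComp (l s) (W s) a b)
      (frameComp (l t) W' a b
        - ∑ c, (∑ β, dualFrame (l t) a β * l' c β) * frameComp (l t) (W t) c b
        - ∑ c, (∑ β, dualFrame (l t) b β * l' c β) * frameComp (l t) (W t) a c) t := by
  have h := HasDerivAt.fun_sum fun μ (_ : μ ∈ Finset.univ) =>
    (hasDerivAt_dualFrame hl h0 a μ).fun_mul (HasDerivAt.fun_sum fun ν (_ : ν ∈ Finset.univ) =>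
      (hasDerivAt_dualFrame hl h0 b ν).fun_mul (hW μ ν))
  refine h.congr_deriv ?_
  have e1 : ∀ (k : Fin n → ℝ) (Y : Fin n → ℝ),
      ∑ μ, (-∑ c, k c * dualFrame (l t) c μ) * Y μ
        = -∑ c, k c * ∑ μ, dualFrame (l t) c μ * Y μ := fun k Y => by
    simp_rw [Finset.mul_sum, neg_mul, Finset.sum_neg_distrib, Finset.sum_mul]
    rw [Finset.sum_comm]
    simp_rw [mul_assoc]
  rw [Finset.sum_add_distrib, e1]
  simp_rw [Finset.sum_add_distrib, e1, mul_add, Finset.sum_add_distrib]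
  have e2 : ∀ k : Fin n → ℝ, ∑ μ, dualFrame (l t) a μ * -∑ c, k c
        * ∑ ν, dualFrame (l t) c ν * W t μ ν
      = -∑ c, k c * frameComp (l t) (W t) a c := fun k => by
    simp only [frameComp, mul_neg, Finset.sum_neg_distrib, Finset.mul_sum]
    rw [Finset.sum_comm]
    congr 1
    exact Finset.sum_congr rfl fun c _ => Finset.sum_congr rfl fun μ _ =>
      Finset.sum_congr rfl fun ν _ => by ring
  rw [e2]
  simp only [frameComp]
  ring

/-- The momentum `∂H/∂T^j_{bc}`. -/
def momentum (T : Fin n → Fin n → Fin n → ℝ) (j b c : Fin n) : ℝ :=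
  2 * T b j c - 2 * (if c = j then torsionTrace T b else 0)

/-- The antisymmetrized momentum. -/
def superpotential (T : Fin n → Fin n → Fin n → ℝ) (j b c : Fin n) : ℝ :=
  momentum T j b c - momentum T j c b

/-- All entries of `T` vary independently here. In each quadratic term the two halves of the product
rule agree, which explains the factors 2 in `momentum`. -/
theorem hasDerivAt_frameH {T : ℝ → Fin n → Fin n → Fin n → ℝ} {T' : Fin n → Fin n → Fin n → ℝ}
    (hT : ∀ i a b, HasDerivAt (fun s => T s i a b) (T' i a b) t) :
    HasDerivAt (fun s => ∑ a, frameH (T s) a a)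
      (∑ j, ∑ b, ∑ c, T' j b c * momentum (T t) j b c) t := by
  have h := HasDerivAt.fun_sum fun a (_ : a ∈ Finset.univ) =>
    (HasDerivAt.fun_sum fun c (_ : c ∈ Finset.univ) =>
      HasDerivAt.fun_sum fun e (_ : e ∈ Finset.univ) => (hT c e a).fun_mul (hT e c a)).fun_sub
    ((HasDerivAt.fun_sum fun i (_ : i ∈ Finset.univ) => hT i a i).fun_mul
      (HasDerivAt.fun_sum fun i (_ : i ∈ Finset.univ) => hT i a i))
  refine h.congr_deriv ?_
  simp only [momentum, mul_sub, Finset.sum_sub_distrib]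
  congr 1
  · have e1 : ∀ a, ∑ c, ∑ e, (T' c e a * T t e c a + T t c e a * T' e c a)
        = ∑ j, ∑ b, T' j b a * (2 * T t b j a) := fun a => by
      simp_rw [Finset.sum_add_distrib]
      rw [Finset.sum_comm (f := fun c e => T t c e a * T' e c a), ← Finset.sum_add_distrib]
      refine Finset.sum_congr rfl fun j _ => ?_
      rw [← Finset.sum_add_distrib]
      exact Finset.sum_congr rfl fun b _ => by ring
    simp_rw [e1]
    rw [Finset.sum_comm]
    refine Finset.sum_congr rfl fun j _ => ?_
    rw [Finset.sum_comm]
  · simp only [mul_ite, mul_zero, Finset.sum_ite_eq', Finset.mem_univ, if_true]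
    rw [Finset.sum_comm]
    refine Finset.sum_congr rfl fun a _ => ?_
    rw [← Finset.sum_mul]
    simp only [torsionTrace]
    ring

/-- The torsion is an antisymmetrized derivative; moving the antisymmetrization to the momentum
makes `superpotential` appear. -/
theorem sum_antisymmetrize_mul (A m : Fin n → Fin n → ℝ) :
    ∑ b, ∑ c, (A b c - A c b) * m b c = ∑ b, ∑ c, A b c * (m b c - m c b) := by
  simp only [sub_mul, mul_sub, Finset.sum_sub_distrib]
  rw [Finset.sum_comm (f := fun b c => A c b * m b c)]

end Variation

/-! ### First variation of the horizontal Lagrangian. -/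

namespace Jet

variable {n : ℕ} (N : Fin n → Fin n → ℝ)

theorem lagrangian_eq {J : Jet n} (hJ : J.detLam ≠ 0) :
    J.lagrangian N = J.detLam * ∑ a, frameH (J.tor N) a a := by
  rw [lagrangian, HScalar_eq N hJ]

/-- The first variation of the horizontal Lagrangian along a curve of jets. -/
theorem hasDerivAt_lagrangian {J : ℝ → Jet n} {l' : Fin n → Fin n → ℝ}
    {D' : Fin n → Fin n → Fin n → ℝ} {t : ℝ}
    (hl : ∀ i α, HasDerivAt (fun s => (J s).val i α) (l' i α) t)
    (hD : ∀ i μ ν, HasDerivAt (fun s => (J s).hor N i μ ν) (D' i μ ν) t)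
    (h0 : (J t).detLam ≠ 0) :
    HasDerivAt (fun s => (J s).lagrangian N)
      ((J t).detLam * ((∑ i, ∑ α, dualFrame (J t).val i α * l' i α)
          * ∑ a, frameH ((J t).tor N) a a
        + ∑ j, ∑ b, ∑ c, (frameTorsion (J t).val D' j b c
            - (∑ d, (∑ β, dualFrame (J t).val b β * l' d β) * (J t).tor N j d c)
            - ∑ d, (∑ β, dualFrame (J t).val c β * l' d β) * (J t).tor N j b d)
          * momentum ((J t).tor N) j b c)) t := by
  have hd : HasDerivAt (fun s => (J s).val) l' t :=
    hasDerivAt_pi.2 fun i => hasDerivAt_pi.2 fun α => hl i α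
  have hev : ∀ᶠ s in nhds t, (J s).detLam ≠ 0 :=
    ((contDiff_det.continuous.continuousAt.comp hd.continuousAt).eventually_ne h0)
  have hT : ∀ i a b, HasDerivAt (fun s => (J s).tor N i a b) _ t := fun i a b =>
    hasDerivAt_frameComp (W := fun s μ ν => (J s).hor N i μ ν - (J s).hor N i ν μ) hl h0
      (fun μ ν => (hD i μ ν).sub (hD i ν μ)) a b
  have h := (hasDerivAt_det hl h0).mul (hasDerivAt_frameH hT)
  refine (h.congr_of_eventuallyEq ?_).congr_deriv ?_
  · filter_upwards [hev] with s hs using lagrangian_eq N hs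
  · rw [mul_add, mul_assoc]
    rfl

end Jet

end EAP

namespace EAP
namespace Jet

/-! ### Partial derivatives of the horizontal Lagrangian -/

variable {n : ℕ} (N : Fin n → Fin n → ℝ)

/-- The momentum `∂ℋ/∂λ_{jβ,γ}`. -/
def conjMomentum (J : Jet n) (j β γ : Fin n) : ℝ :=
  J.detLam * ∑ b, dualFrame J.val b β * ∑ c, dualFrame J.val c γ * superpotential (J.tor N) j b c

/-- Both `λ_{jβ,γ}` and `λ_{jβ;a}` enter only through `δ_γ λ_{jβ}`, so one formula for a fixed
coframe serves both partial derivatives. -/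
theorem hasDerivAt_lagrangian_of_val_const {J : ℝ → Jet n} {D' : Fin n → Fin n → Fin n → ℝ} {t : ℝ}
    (hl : ∀ s, (J s).val = (J t).val)
    (hD : ∀ i μ ν, HasDerivAt (fun s => (J s).hor N i μ ν) (D' i μ ν) t)
    (h0 : (J t).detLam ≠ 0) :
    HasDerivAt (fun s => (J s).lagrangian N)
      ((J t).detLam * ∑ j, ∑ b, ∑ c, frameComp (J t).val (D' j) b c
        * superpotential ((J t).tor N) j b c) t := by
  have h := hasDerivAt_lagrangian N (J := J) (l' := fun _ _ => 0)
    (fun i α => by simpa only [hl] using hasDerivAt_const _ _) hD h0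
  refine h.congr_deriv ?_
  simp only [mul_zero, Finset.sum_const_zero, zero_mul, sub_zero, zero_add, frameTorsion_eq]
  congr 1
  exact Finset.sum_congr rfl fun j _ => sum_antisymmetrize_mul _ _

theorem sum_frameComp_mul (l W M : Fin n → Fin n → ℝ) :
    ∑ b, ∑ c, frameComp l W b c * M b c
      = ∑ μ, ∑ ν, W μ ν * ∑ b, dualFrame l b μ * ∑ c, dualFrame l c ν * M b c := by
  have e : ∀ b c, frameComp l W b c * M b c
      = ∑ μ, ∑ ν, W μ ν * (dualFrame l b μ * (dualFrame l c ν * M b c)) := fun b c => by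
    simp only [frameComp, Finset.sum_mul, Finset.mul_sum]
    exact Finset.sum_congr rfl fun c _ => Finset.sum_congr rfl fun μ _ => by ring
  simp only [e, Finset.mul_sum]
  calc _ = ∑ b, ∑ μ, ∑ c, ∑ ν, W μ ν * (dualFrame l b μ * (dualFrame l c ν * M b c)) :=
        Finset.sum_congr rfl fun b _ => Finset.sum_comm
    _ = ∑ μ, ∑ b, ∑ ν, ∑ c, W μ ν * (dualFrame l b μ * (dualFrame l c ν * M b c)) := by
        rw [Finset.sum_comm]
        exact Finset.sum_congr rfl fun μ _ => Finset.sum_congr rfl fun b _ => Finset.sum_comm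
    _ = _ := Finset.sum_congr rfl fun μ _ => Finset.sum_comm

variable {N} in
theorem partialDx_lagrangian {J : Jet n} (hJ : J.detLam ≠ 0) (j β γ : Fin n) :
    partialDx (lagrangian N) J j β γ = J.conjMomentum N j β γ := by
  let E : Fin n → Fin n → Fin n → ℝ := Pi.single j (Pi.single β (Pi.single γ 1))
  have h := hasDerivAt_lagrangian_of_val_const N (t := 0) (D' := E)
    (J := fun t : ℝ => (⟨J.val, J.dx + t • E, J.dy⟩ : Jet n)) (fun s => rfl)
    (fun i μ ν => by
      have : HasDerivAt (fun t : ℝ => J.dx i μ ν + t * E i μ ν - ∑ a, N a ν * J.dy i μ a)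
          (1 * E i μ ν) 0 := (((hasDerivAt_id (0 : ℝ)).mul_const _).const_add _).sub_const _
      simpa [hor] using this) hJ
  simp only [zero_smul, add_zero] at h
  refine h.deriv.trans ?_
  simp_rw [sum_frameComp_mul, conjMomentum]
  congr 1
  simp only [E]
  rw [Finset.sum_eq_single j, Finset.sum_eq_single β, Finset.sum_eq_single γ]
  · simp
  all_goals simp +contextual [Pi.single_apply]

-- Chain rule for `δ_γ λ_{jβ} = λ_{jβ,γ} - N^a_γ λ_{jβ;a}`, with `N` held fixed.
variable {N} in
theorem partialDy_lagrangian {J : Jet n} (hJ : J.detLam ≠ 0) (j β a : Fin n) :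
    partialDy (lagrangian N) J j β a = -∑ γ, N a γ * J.conjMomentum N j β γ := by
  let E : Fin n → Fin n → Fin n → ℝ := Pi.single j (Pi.single β (Pi.single a 1))
  have h := hasDerivAt_lagrangian_of_val_const N (t := 0)
    (D' := fun i μ ν => - ∑ b, N b ν * E i μ b)
    (J := fun t : ℝ => (⟨J.val, J.dx, J.dy + t • E⟩ : Jet n)) (fun s => rfl)
    (fun i μ ν => by
      have : HasDerivAt (fun t : ℝ => J.dx i μ ν - ∑ a, N a ν * (J.dy i μ a + t * E i μ a))
          (-∑ b, N b ν * (1 * E i μ b)) 0 :=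
        (HasDerivAt.fun_sum fun a _ =>
          (((hasDerivAt_id (0 : ℝ)).mul_const _).const_add _).const_mul _).const_sub _
      simpa [hor] using this) hJ
  simp only [zero_smul, add_zero] at h
  refine h.deriv.trans ?_
  simp_rw [sum_frameComp_mul, conjMomentum]
  have e : ∀ i μ ν, -∑ b, N b ν * E i μ b
      = if i = j then if μ = β then - N a ν else 0 else 0 := fun i μ ν => by
    rw [Finset.sum_eq_single a]
    · by_cases h1 : i = j <;> by_cases h2 : μ = β <;> simp [E, h1, h2]
    · intro b _ hb
      by_cases h1 : i = j <;> by_cases h2 : μ = β <;> simp [E, h1, h2, hb]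
    · simp
  simp only [e]
  rw [Finset.sum_eq_single j, Finset.sum_eq_single β]
  · simp only [if_true, neg_mul, Finset.sum_neg_distrib, mul_neg]
    rw [Finset.mul_sum]
    congr 1
    exact Finset.sum_congr rfl fun c _ => by ring
  all_goals simp +contextual

-- At fixed derivatives, `λ_{jβ}` enters through `|λ|`, which gives the diagonal term, and through
-- the two dual frames in `T`. Contraction with `λ_{dβ}` turns the remaining dual frame vectors into
-- Kronecker deltas.
variable {N} in
theorem sum_coframe_mul_partialVal {J : Jet n} (hJ : J.detLam ≠ 0) (d j : Fin n) :
    ∑ β, J.val d β * partialVal (lagrangian N) J j β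
      = J.detLam * ((if d = j then ∑ a, frameH (J.tor N) a a else 0)
        - ∑ i, ∑ b, J.tor N i j b * superpotential (J.tor N) i d b) := by
  have hp : ∀ β, partialVal (lagrangian N) J j β
      = J.detLam * (dualFrame J.val j β * (∑ a, frameH (J.tor N) a a)
        - ∑ b, dualFrame J.val b β * ∑ i, ∑ c, J.tor N i j c * superpotential (J.tor N) i b c) := by
    intro β
    let E : Fin n → Fin n → ℝ := Pi.single j (Pi.single β 1)
    have h := hasDerivAt_lagrangian N (t := 0) (l' := E) (D' := fun _ _ _ => 0)
      (J := fun t : ℝ => (⟨J.val + t • E, J.dx, J.dy⟩ : Jet n))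
      (fun i α => by
        have : HasDerivAt (fun t : ℝ => J.val i α + t * E i α) (1 * E i α) 0 :=
          ((hasDerivAt_id (0 : ℝ)).mul_const _).const_add _
        simpa using this)
      (fun i μ ν => hasDerivAt_const _ (J.hor N i μ ν)) (by simpa using hJ)
    simp only [zero_smul, add_zero] at h
    refine h.deriv.trans ?_
    have hE : ∀ i α, E i α = if i = j then if α = β then 1 else 0 else 0 := fun i α => by
      by_cases h1 : i = j <;> by_cases h2 : α = β <;> simp [E, h1, h2]
    change J.detLam * _ = _
    congr 1
    rw [sub_eq_add_neg]
    congr 1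
    · congr 1
      simp [hE]
    · have hF : ∀ j b c, frameTorsion J.val (fun _ _ _ => 0) j b c = 0 := by
        simp [frameTorsion, frameComp]
      have hs : ∀ (b : Fin n) (F : Fin n → ℝ),
          ∑ d, (∑ β, dualFrame J.val b β * E d β) * F d = dualFrame J.val b β * F j := by
        intro b F
        simp [hE]
      simp only [hs, hF]
      -- By antisymmetry of the torsion, varying the frame in the second lower slot is minus the
      -- transpose of varying it in the first; together they form one antisymmetrization.
      have ht : ∀ i, ∑ b, ∑ c, (0 - dualFrame J.val b β * J.tor N i j c
            - dualFrame J.val c β * J.tor N i b j) * momentum (J.tor N) i b c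
          = -∑ b, ∑ c, dualFrame J.val b β * J.tor N i j c
              * superpotential (J.tor N) i b c := fun i => by
        simp only [superpotential]
        rw [← sum_antisymmetrize_mul, ← Finset.sum_neg_distrib]
        refine Finset.sum_congr rfl fun b _ => ?_
        rw [← Finset.sum_neg_distrib]
        refine Finset.sum_congr rfl fun c _ => ?_
        rw [J.tor_antisymm N i b j]
        ring
      simp only [ht, Finset.sum_neg_distrib, Finset.mul_sum]
      congr 1
      rw [Finset.sum_comm]
      exact Finset.sum_congr rfl fun b _ => Finset.sum_congr rfl fun i _ =>
        Finset.sum_congr rfl fun c _ => by ring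
  have hk : ∀ β, J.val d β * partialVal (lagrangian N) J j β
      = J.detLam * ((J.val d β * dualFrame J.val j β) * (∑ a, frameH (J.tor N) a a)
        - J.val d β * ∑ b, dualFrame J.val b β
          * ∑ i, ∑ c, J.tor N i j c * superpotential (J.tor N) i b c) := fun β => by
    rw [hp]; ring
  simp only [hk]
  rw [← Finset.mul_sum, Finset.sum_sub_distrib, sum_coframe_dualFrame hJ, ← Finset.sum_mul,
    sum_mul_dualFrame hJ]
  simp

end Jet
/-! ### Calculus of local fields -/

section Calculus

variable {n : ℕ}

theorem sum_mul_sum_swap (x : Fin n → ℝ) (F : Fin n → Fin n → ℝ) :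
    ∑ β, x β * ∑ b, F β b = ∑ b, ∑ β, x β * F β b := by
  simp only [Finset.mul_sum]
  exact Finset.sum_comm

theorem sum_mul_sum_add (x : Fin n → ℝ) (F G : Fin n → Fin n → ℝ) :
    ∑ β, x β * ∑ b, (F β b + G β b)
      = (∑ b, ∑ β, x β * F β b) + ∑ β, x β * ∑ b, G β b := by
  simp only [Finset.sum_add_distrib, mul_add, sum_mul_sum_swap]

/-- A smooth nonlinear connection and a smooth coframe on the open set `U`. -/
structure SmoothCoframeOn (N l : TCoord n → Fin n → Fin n → ℝ) (U : Set (TCoord n)) : Prop where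
  isOpen : IsOpen U
  smooth_N : ∀ a μ, ContDiffOn ℝ ∞ (fun p => N p a μ) U
  smooth_l : ∀ i β, ContDiffOn ℝ ∞ (fun p => l p i β) U
  det_ne_zero : ∀ p ∈ U, (Matrix.of (l p)).det ≠ 0

/-- The vector `δ_μ` at the point `p`. -/
def horVec (N : TCoord n → Fin n → Fin n → ℝ) (μ : Fin n) (p : TCoord n) : TCoord n :=
  (unitVec μ, -∑ a, N p a μ • unitVec a)

theorem horVec_eq (N : TCoord n → Fin n → Fin n → ℝ) (μ : Fin n) (p : TCoord n) :
    horVec N μ p = (unitVec μ, 0) - ∑ a, N p a μ • ((0 : Coord n), unitVec a) := by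
  ext1
  · simp [horVec, Prod.fst_sum]
  · simp [horVec, Prod.snd_sum]

variable {N l : TCoord n → Fin n → Fin n → ℝ} {U : Set (TCoord n)} {f g : TCoord n → ℝ}
  {p : TCoord n}

theorem dX_eq_fderiv (hf : DifferentiableAt ℝ f p) (γ : Fin n) :
    dX γ f p = fderiv ℝ f p (unitVec γ, 0) := hf.lineDeriv_eq_fderiv

theorem dY_eq_fderiv (hf : DifferentiableAt ℝ f p) (a : Fin n) :
    dY a f p = fderiv ℝ f p (0, unitVec a) := hf.lineDeriv_eq_fderiv

theorem delta_eq_fderiv (hf : DifferentiableAt ℝ f p) (μ : Fin n) :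
    delta N μ f p = fderiv ℝ f p (horVec N μ p) := by
  rw [delta, dX_eq_fderiv hf, horVec_eq, map_sub, map_sum]
  simp only [map_smul, smul_eq_mul, dY_eq_fderiv hf]

theorem hasDerivAt_delta (hf : DifferentiableAt ℝ f p) (μ : Fin n) :
    HasDerivAt (fun t : ℝ => f (p + t • horVec N μ p)) (delta N μ f p) 0 := by
  rw [delta_eq_fderiv hf]
  exact hf.hasFDerivAt.hasLineDerivAt _

/-- This transfers the one-parameter variation formulas to `δ_μ`, by moving along the line through
`p` whose direction is `δ_μ` frozen at `p`. -/
theorem delta_eq_of_hasDerivAt (hf : DifferentiableAt ℝ f p) {μ : Fin n} {c : ℝ}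
    (h : HasDerivAt (fun t : ℝ => f (p + t • horVec N μ p)) c 0) : delta N μ f p = c :=
  (hasDerivAt_delta hf μ).unique h

theorem delta_congr (h : f =ᶠ[nhds p] g) (μ : Fin n) : delta N μ f p = delta N μ g p := by
  simp only [delta, dX, dY, h.lineDeriv_eq]

theorem delta_mul (hf : DifferentiableAt ℝ f p) (hg : DifferentiableAt ℝ g p) (μ : Fin n) :
    delta N μ (fun z => f z * g z) p = delta N μ f p * g p + f p * delta N μ g p := by
  rw [delta_eq_fderiv (hf.fun_mul hg), delta_eq_fderiv hf, delta_eq_fderiv hg, fderiv_fun_mul hf hg]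
  simp
  ring

theorem delta_const_mul (hf : DifferentiableAt ℝ f p) (k : ℝ) (μ : Fin n) :
    delta N μ (fun z => k * f z) p = k * delta N μ f p := by
  rw [delta_eq_fderiv (hf.const_mul k), delta_eq_fderiv hf, fderiv_const_mul hf]
  simp

theorem delta_sub (hf : DifferentiableAt ℝ f p) (hg : DifferentiableAt ℝ g p) (μ : Fin n) :
    delta N μ (fun z => f z - g z) p = delta N μ f p - delta N μ g p := by
  rw [delta_eq_fderiv (hf.fun_sub hg), delta_eq_fderiv hf, delta_eq_fderiv hg, fderiv_fun_sub hf hg]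
  simp

theorem delta_sum {ι : Type*} {s : Finset ι} {F : ι → TCoord n → ℝ}
    (hF : ∀ i ∈ s, DifferentiableAt ℝ (F i) p) (μ : Fin n) :
    delta N μ (fun z => ∑ i ∈ s, F i z) p = ∑ i ∈ s, delta N μ (F i) p := by
  rw [delta_eq_fderiv (DifferentiableAt.fun_sum hF), fderiv_fun_sum hF]
  simp only [sum_apply]
  exact Finset.sum_congr rfl fun i hi => (delta_eq_fderiv (hF i hi) μ).symm

theorem dY_mul (hf : DifferentiableAt ℝ f p) (hg : DifferentiableAt ℝ g p) (a : Fin n) :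
    dY a (fun z => f z * g z) p = dY a f p * g p + f p * dY a g p := by
  rw [dY_eq_fderiv (hf.fun_mul hg), dY_eq_fderiv hf, dY_eq_fderiv hg, fderiv_fun_mul hf hg]
  simp
  ring

theorem dY_neg_sum {ι : Type*} {s : Finset ι} {F : ι → TCoord n → ℝ}
    (hF : ∀ i ∈ s, DifferentiableAt ℝ (F i) p) (a : Fin n) :
    dY a (fun z => -∑ i ∈ s, F i z) p = -∑ i ∈ s, dY a (F i) p := by
  rw [dY_eq_fderiv (DifferentiableAt.fun_sum hF).fun_neg, fderiv_fun_neg, fderiv_fun_sum hF]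
  simp only [sum_apply, neg_apply]
  congr 1
  exact Finset.sum_congr rfl fun i hi => (dY_eq_fderiv (hF i hi) a).symm

theorem _root_.ContDiffOn.differentiableAt_of_isOpen (hf : ContDiffOn ℝ ∞ f U) (hU : IsOpen U)
    (hp : p ∈ U) : DifferentiableAt ℝ f p :=
  (hf.contDiffAt (hU.mem_nhds hp)).differentiableAt (by simp)

theorem contDiffOn_lineDeriv (hf : ContDiffOn ℝ ∞ f U) (hU : IsOpen U) (v : TCoord n) :
    ContDiffOn ℝ ∞ (fun p => lineDeriv ℝ f p v) U := by
  refine ((hf.fderiv_of_isOpen hU (m := ∞) (by simp)).clm_apply (contDiffOn_const (c := v))).congr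
    fun p hp => ?_
  exact (hf.differentiableAt_of_isOpen hU hp).lineDeriv_eq_fderiv

/-! ### Smoothness of the geometric objects and derivatives of the frame. -/

namespace SmoothCoframeOn

theorem contDiffOn_delta (h : SmoothCoframeOn N l U) (hf : ContDiffOn ℝ ∞ f U) (μ : Fin n) :
    ContDiffOn ℝ ∞ (delta N μ f) U :=
  (contDiffOn_lineDeriv hf h.isOpen _).sub <| ContDiffOn.sum fun a _ =>
    (h.smooth_N a μ).mul (contDiffOn_lineDeriv hf h.isOpen _)

theorem contDiffOn_coframe (h : SmoothCoframeOn N l U) : ContDiffOn ℝ ∞ l U :=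
  contDiffOn_pi.2 fun i => contDiffOn_pi.2 fun β => h.smooth_l i β

theorem contDiffOn_dualFrame (h : SmoothCoframeOn N l U) (i α : Fin n) :
    ContDiffOn ℝ ∞ (fun p => dualFrame (l p) i α) U := fun p hp =>
  (contDiffAt_dualFrame (h.det_ne_zero p hp) i α).comp_contDiffWithinAt p (h.contDiffOn_coframe p hp)

theorem contDiffOn_detLam (h : SmoothCoframeOn N l U) :
    ContDiffOn ℝ ∞ (fun p => (jet l p).detLam) U :=
  contDiff_det.comp_contDiffOn h.contDiffOn_coframe

theorem contDiffOn_hor (h : SmoothCoframeOn N l U) (i β μ : Fin n) :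
    ContDiffOn ℝ ∞ (fun p => (jet l p).hor (N p) i β μ) U :=
  h.contDiffOn_delta (h.smooth_l i β) μ

theorem contDiffOn_tor (h : SmoothCoframeOn N l U) (i a b : Fin n) :
    ContDiffOn ℝ ∞ (fun p => (jet l p).tor (N p) i a b) U := by
  unfold Jet.tor frameTorsion frameComp
  exact ContDiffOn.sum fun μ _ => (h.contDiffOn_dualFrame a μ).mul <| ContDiffOn.sum fun ν _ =>
    (h.contDiffOn_dualFrame b ν).mul ((h.contDiffOn_hor i μ ν).sub (h.contDiffOn_hor i ν μ))

theorem contDiffOn_torsionTrace (h : SmoothCoframeOn N l U) (a : Fin n) :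
    ContDiffOn ℝ ∞ (fun p => torsionTrace ((jet l p).tor (N p)) a) U :=
  ContDiffOn.sum fun i _ => h.contDiffOn_tor i a i

theorem contDiffOn_momentum (h : SmoothCoframeOn N l U) (j b c : Fin n) :
    ContDiffOn ℝ ∞ (fun p => momentum ((jet l p).tor (N p)) j b c) U := by
  refine (contDiffOn_const.mul (h.contDiffOn_tor b j c)).sub (contDiffOn_const.mul ?_)
  by_cases hc : c = j
  · simpa [hc] using h.contDiffOn_torsionTrace b
  · simpa [hc] using contDiffOn_const

theorem contDiffOn_superpotential (h : SmoothCoframeOn N l U) (j b c : Fin n) :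
    ContDiffOn ℝ ∞ (fun p => superpotential ((jet l p).tor (N p)) j b c) U :=
  (h.contDiffOn_momentum j b c).sub (h.contDiffOn_momentum j c b)

theorem contDiffOn_conjMomentum (h : SmoothCoframeOn N l U) (j β γ : Fin n) :
    ContDiffOn ℝ ∞ (fun p => (jet l p).conjMomentum (N p) j β γ) U :=
  h.contDiffOn_detLam.mul <| ContDiffOn.sum fun b _ => (h.contDiffOn_dualFrame b β).mul <|
    ContDiffOn.sum fun c _ => (h.contDiffOn_dualFrame c γ).mul (h.contDiffOn_superpotential j b c)

theorem differentiableAt (h : SmoothCoframeOn N l U) (hp : p ∈ U) (hf : ContDiffOn ℝ ∞ f U) :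
    DifferentiableAt ℝ f p := hf.differentiableAt_of_isOpen h.isOpen hp

theorem delta_dualFrame (h : SmoothCoframeOn N l U) (hp : p ∈ U) (i α μ : Fin n) :
    delta N μ (fun z => dualFrame (l z) i α) p
      = -∑ c, (∑ β, dualFrame (l p) i β * (jet l p).hor (N p) c β μ) * dualFrame (l p) c α := by
  refine delta_eq_of_hasDerivAt (h.differentiableAt hp (h.contDiffOn_dualFrame i α)) ?_
  have := hasDerivAt_dualFrame (t := 0) (l := fun t : ℝ => l (p + t • horVec N μ p))
    (fun c β => hasDerivAt_delta (h.differentiableAt hp (h.smooth_l c β)) μ)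
    (by simpa using h.det_ne_zero p hp) i α
  simp only [zero_smul, add_zero] at this
  exact this

theorem delta_detLam (h : SmoothCoframeOn N l U) (hp : p ∈ U) (μ : Fin n) :
    delta N μ (fun z => (jet l z).detLam) p
      = (jet l p).detLam * ∑ i, ∑ α, dualFrame (l p) i α * (jet l p).hor (N p) i α μ := by
  refine delta_eq_of_hasDerivAt (h.differentiableAt hp h.contDiffOn_detLam) ?_
  have := hasDerivAt_det (t := 0) (l := fun t : ℝ => l (p + t • horVec N μ p))
    (fun c β => hasDerivAt_delta (h.differentiableAt hp (h.smooth_l c β)) μ)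
    (by simpa using h.det_ne_zero p hp)
  simp only [zero_smul, add_zero] at this
  exact this

end SmoothCoframeOn

/-- The derivative `λ_c^γ δ_γ f` in the direction of the frame. -/
def frameDelta (N l : TCoord n → Fin n → Fin n → ℝ) (c : Fin n) (f : TCoord n → ℝ)
    (p : TCoord n) : ℝ :=
  ∑ γ, dualFrame (l p) c γ * delta N γ f p

/-! ### The Euler–Lagrange expression as a horizontal divergence. -/

namespace SmoothCoframeOn

/-- In `∂/∂y^a` of `-N^a_γ P^γ`, the terms differentiating `P` complete `∂P^γ/∂x^γ` to `δ_γ P^γ`.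
The terms differentiating `N` are the source of every `N^a_{ε;a}` in the field equations. -/
theorem eulerLagrange_eq (h : SmoothCoframeOn N l U) (hp : p ∈ U) (j β : Fin n) :
    eulerLagrange N l p j β = Jet.partialVal (Jet.lagrangian (N p)) (jet l p) j β
      - ∑ γ, delta N γ (fun z => (jet l z).conjMomentum (N z) j β γ) p
      + ∑ γ, divN N p γ * (jet l p).conjMomentum (N p) j β γ := by
  have hU := h.isOpen.mem_nhds hp
  have hP := fun γ => h.differentiableAt hp (h.contDiffOn_conjMomentum j β γ)
  have hN := fun a γ => h.differentiableAt hp (h.smooth_N a γ)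
  have h1 : ∀ γ, dX γ (fun z => Jet.partialDx (Jet.lagrangian (N z)) (jet l z) j β γ) p
      = dX γ (fun z => (jet l z).conjMomentum (N z) j β γ) p := fun γ => by
    refine Filter.EventuallyEq.lineDeriv_eq ?_
    filter_upwards [hU] with z hz using
      Jet.partialDx_lagrangian (J := jet l z) (h.det_ne_zero z hz) j β γ
  have h2 : ∀ a, dY a (fun z => Jet.partialDy (Jet.lagrangian (N z)) (jet l z) j β a) p
      = -∑ γ, (dY a (fun z => N z a γ) p * (jet l p).conjMomentum (N p) j β γ
        + N p a γ * dY a (fun z => (jet l z).conjMomentum (N z) j β γ) p) := fun a => by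
    have : dY a (fun z => Jet.partialDy (Jet.lagrangian (N z)) (jet l z) j β a) p
        = dY a (fun z => -∑ γ, N z a γ * (jet l z).conjMomentum (N z) j β γ) p := by
      refine Filter.EventuallyEq.lineDeriv_eq ?_
      filter_upwards [hU] with z hz using
      Jet.partialDy_lagrangian (J := jet l z) (h.det_ne_zero z hz) j β a
    rw [this, dY_neg_sum fun γ _ => (hN a γ).fun_mul (hP γ)]
    congr 1
    exact Finset.sum_congr rfl fun γ _ => dY_mul (hN a γ) (hP γ) a
  simp only [eulerLagrange, h1, h2, delta, divN, Finset.sum_neg_distrib, Finset.sum_add_distrib,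
    Finset.sum_sub_distrib, Finset.sum_mul]
  rw [Finset.sum_comm (f := fun γ a => dY a (fun z => N z a γ) p * _),
    Finset.sum_comm (f := fun γ a => N p a γ * _)]
  ring

/-- `λ_{aβ} δ_γ λ_b^β`. -/
theorem sum_coframe_mul_delta_dualFrame (h : SmoothCoframeOn N l U) (hp : p ∈ U) (a b γ : Fin n) :
    ∑ β, l p a β * delta N γ (fun z => dualFrame (l z) b β) p
      = -∑ σ, dualFrame (l p) b σ * (jet l p).hor (N p) a σ γ := by
  simp only [h.delta_dualFrame hp, mul_neg, Finset.sum_neg_distrib]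
  congr 1
  rw [← sum_coframe_dualFrame (h.det_ne_zero p hp)
    (fun c => ∑ σ, dualFrame (l p) b σ * (jet l p).hor (N p) c σ γ) a]
  refine Finset.sum_congr rfl fun β _ => ?_
  congr 1
  exact Finset.sum_congr rfl fun c _ => mul_comm _ _

/-- `δ_γ (|λ| λ_c^γ) = -|λ| λ_c^γ C_γ`. -/
theorem sum_delta_detLam_mul_dualFrame (h : SmoothCoframeOn N l U) (hp : p ∈ U) (c : Fin n) :
    ∑ γ, delta N γ (fun z => (jet l z).detLam * dualFrame (l z) c γ) p
      = -((jet l p).detLam * torsionTrace ((jet l p).tor (N p)) c) := by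
  have h1 : ∀ γ, delta N γ (fun z => (jet l z).detLam * dualFrame (l z) c γ) p
      = (jet l p).detLam * (dualFrame (l p) c γ
          * (∑ i, ∑ α, dualFrame (l p) i α * (jet l p).hor (N p) i α γ)
        - ∑ i, (∑ β, dualFrame (l p) c β * (jet l p).hor (N p) i β γ) * dualFrame (l p) i γ) :=
    fun γ => by
      rw [delta_mul (h.differentiableAt hp h.contDiffOn_detLam)
        (h.differentiableAt hp (h.contDiffOn_dualFrame c γ)), h.delta_detLam hp,
        h.delta_dualFrame hp]
      ring
  simp only [h1]
  rw [← Finset.mul_sum, ← mul_neg]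
  congr 1
  rw [Finset.sum_sub_distrib]
  -- The derivatives of `|λ|` and of `λ_c^γ` yield the two traces of the frame components of `δλ_i`;
  -- their difference is minus the torsion trace.
  have h2 : ∑ γ, dualFrame (l p) c γ
        * (∑ i, ∑ α, dualFrame (l p) i α * (jet l p).hor (N p) i α γ)
      = ∑ i, frameComp (l p) ((jet l p).hor (N p) i) i c := by
    simp only [frameComp, Finset.mul_sum]
    rw [Finset.sum_comm]
    refine Finset.sum_congr rfl fun i _ => ?_
    rw [Finset.sum_comm]
    exact Finset.sum_congr rfl fun α _ => Finset.sum_congr rfl fun γ _ => by ring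
  have h3 : ∑ γ, ∑ i, (∑ β, dualFrame (l p) c β * (jet l p).hor (N p) i β γ)
        * dualFrame (l p) i γ
      = ∑ i, frameComp (l p) ((jet l p).hor (N p) i) c i := by
    simp only [frameComp, Finset.mul_sum, Finset.sum_mul]
    rw [Finset.sum_comm]
    refine Finset.sum_congr rfl fun i _ => ?_
    rw [Finset.sum_comm]
    exact Finset.sum_congr rfl fun α _ => Finset.sum_congr rfl fun γ _ => by ring
  rw [h2, h3]
  simp only [torsionTrace, Jet.tor, frameTorsion_eq, Finset.sum_sub_distrib, neg_sub]
  rfl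

theorem delta_conjMomentum (h : SmoothCoframeOn N l U) (hp : p ∈ U) (j β γ : Fin n) :
    delta N γ (fun z => (jet l z).conjMomentum (N z) j β γ) p
      = ∑ b, (delta N γ (fun z => dualFrame (l z) b β) p * ((jet l p).detLam
            * ∑ c, dualFrame (l p) c γ * superpotential ((jet l p).tor (N p)) j b c)
          + dualFrame (l p) b β * ∑ c,
            (delta N γ (fun z => (jet l z).detLam * dualFrame (l z) c γ) p
                * superpotential ((jet l p).tor (N p)) j b c
              + (jet l p).detLam * dualFrame (l p) c γ
                * delta N γ (fun z => superpotential ((jet l z).tor (N z)) j b c) p)) := by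
  -- The density `|λ|` is grouped with `λ_c^γ`, since summing over `γ` then produces the divergence
  -- already computed.
  have e : (fun z => (jet l z).conjMomentum (N z) j β γ) = fun z =>
      ∑ b, dualFrame (l z) b β * ∑ c, ((jet l z).detLam * dualFrame (l z) c γ)
        * superpotential ((jet l z).tor (N z)) j b c := by
    ext z
    simp only [Jet.conjMomentum, Finset.mul_sum]
    exact Finset.sum_congr rfl fun b _ => Finset.sum_congr rfl fun c _ => by
      simp only [jet]; ring
  have hd := fun b α => h.differentiableAt hp (h.contDiffOn_dualFrame b α)
  have hdet := h.differentiableAt hp h.contDiffOn_detLam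
  have hs := fun b c => h.differentiableAt hp (h.contDiffOn_superpotential j b c)
  have hc : ∀ b, ∀ c ∈ Finset.univ, DifferentiableAt ℝ (fun z =>
      ((jet l z).detLam * dualFrame (l z) c γ) * superpotential ((jet l z).tor (N z)) j b c) p :=
    fun b c _ => (hdet.fun_mul (hd c γ)).fun_mul (hs b c)
  rw [e, delta_sum fun b _ => (hd b β).fun_mul (DifferentiableAt.fun_sum (hc b))]
  refine Finset.sum_congr rfl fun b _ => ?_
  rw [delta_mul (hd b β) (DifferentiableAt.fun_sum (hc b)), delta_sum (hc b)]
  congr 2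
  · simp only [Finset.mul_sum, mul_assoc]
  · exact Finset.sum_congr rfl fun c _ => delta_mul (hdet.fun_mul (hd c γ)) (hs b c) γ

theorem sum_coframe_mul_delta_conjMomentum (h : SmoothCoframeOn N l U) (hp : p ∈ U)
    (a j : Fin n) :
    ∑ β, l p a β * ∑ γ, delta N γ (fun z => (jet l z).conjMomentum (N z) j β γ) p
      = (jet l p).detLam *
        ((∑ c, frameDelta N l c (fun z => superpotential ((jet l z).tor (N z)) j a c) p)
          - (∑ c, torsionTrace ((jet l p).tor (N p)) c
            * superpotential ((jet l p).tor (N p)) j a c)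
          - ∑ b, ∑ c, frameComp (l p) ((jet l p).hor (N p) a) b c
            * superpotential ((jet l p).tor (N p)) j b c) := by
  set M := superpotential ((jet l p).tor (N p)) j with hM
  have h0 := h.det_ne_zero p hp
  have h1 : ∀ γ, ∑ β, l p a β * delta N γ (fun z => (jet l z).conjMomentum (N z) j β γ) p
      = -(∑ b, (∑ σ, dualFrame (l p) b σ * (jet l p).hor (N p) a σ γ)
          * ((jet l p).detLam * ∑ c, dualFrame (l p) c γ * M b c))
        + ∑ c, (delta N γ (fun z => (jet l z).detLam * dualFrame (l z) c γ) p * M a c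
              + (jet l p).detLam * dualFrame (l p) c γ
                * delta N γ (fun z => superpotential ((jet l z).tor (N z)) j a c) p) := fun γ => by
    simp only [h.delta_conjMomentum hp]
    rw [sum_mul_sum_add, sum_coframe_dualFrame h0]
    congr 1
    rw [← Finset.sum_neg_distrib]
    refine Finset.sum_congr rfl fun b _ => ?_
    rw [← neg_mul, ← h.sum_coframe_mul_delta_dualFrame hp, Finset.sum_mul]
    exact Finset.sum_congr rfl fun β _ => by ring
  have h2 : ∑ γ, ∑ b, (∑ σ, dualFrame (l p) b σ * (jet l p).hor (N p) a σ γ)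
          * ((jet l p).detLam * ∑ c, dualFrame (l p) c γ * M b c)
      = (jet l p).detLam * ∑ b, ∑ c, frameComp (l p) ((jet l p).hor (N p) a) b c * M b c := by
    rw [Finset.sum_comm, Finset.mul_sum]
    refine Finset.sum_congr rfl fun b _ => ?_
    simp only [frameComp, Finset.mul_sum, Finset.sum_mul]
    rw [Finset.sum_comm]
    refine Finset.sum_congr rfl fun c _ => ?_
    rw [Finset.sum_comm]
    exact Finset.sum_congr rfl fun σ _ => Finset.sum_congr rfl fun γ _ => by ring
  rw [sum_mul_sum_swap]
  simp only [h1, Finset.sum_add_distrib, Finset.sum_neg_distrib, h2]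
  rw [Finset.sum_comm (f := fun γ c => _ * M a c)]
  simp only [← Finset.sum_mul, h.sum_delta_detLam_mul_dualFrame hp]
  rw [Finset.sum_comm (f := fun γ c => _ * delta N γ _ p)]
  simp only [frameDelta, mul_assoc, ← Finset.mul_sum, neg_mul, Finset.sum_neg_distrib]
  ring

end SmoothCoframeOn

end Calculus

section FieldEquations

variable {n : ℕ} {N l : TCoord n → Fin n → Fin n → ℝ} {U : Set (TCoord n)} {p : TCoord n}

/-! ### Tensors in terms of frame components -/

theorem Gam_eq (κ μ ν : Fin n) :
    Gam N l p κ μ ν = ∑ i, dualFrame (l p) i κ * (jet l p).hor (N p) i μ ν := rfl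

theorem LamDown_eq (h0 : (jet l p).detLam ≠ 0) (β μ ν : Fin n) :
    LamDown N l p β μ ν = ∑ i, l p i β * pull (l p) ((jet l p).tor (N p) i) μ ν := by
  unfold LamDown Lam
  simp_rw [Jet.Lam_eq (N p) h0]
  exact Jet.sum_gDown_mul h0 β _

theorem LamDownUp_eq (h0 : (jet l p).detLam ≠ 0) (μ ν ε : Fin n) :
    LamDownUp N l p μ ν ε
      = ∑ b, dualFrame (l p) b ε * pull (l p) (fun i a => (jet l p).tor (N p) i a b) μ ν := by
  have h1 : ∀ α, LamDown N l p μ ν α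
      = ∑ b, l p b α * pull (l p) (fun i a => (jet l p).tor (N p) i a b) μ ν := fun α => by
    rw [LamDown_eq h0]
    simp only [pull, Finset.mul_sum]
    calc _ = ∑ i, ∑ b, ∑ a, l p i μ * (l p a ν * (l p b α * (jet l p).tor (N p) i a b)) :=
          Finset.sum_congr rfl fun i _ => Finset.sum_comm
      _ = _ := by
        rw [Finset.sum_comm]
        exact Finset.sum_congr rfl fun b _ => Finset.sum_congr rfl fun i _ =>
          Finset.sum_congr rfl fun a _ => by ring
  unfold LamDownUp
  simp_rw [h1]
  exact Jet.sum_gUp_mul h0 ε _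

theorem CDown_eq (h0 : (jet l p).detLam ≠ 0) (μ : Fin n) :
    CDown N l p μ = ∑ a, l p a μ * torsionTrace ((jet l p).tor (N p)) a :=
  Jet.basic_eq (N p) h0 μ

theorem CUp_eq (h0 : (jet l p).detLam ≠ 0) (ε : Fin n) :
    CUp N l p ε = ∑ a, dualFrame (l p) a ε * torsionTrace ((jet l p).tor (N p)) a := by
  unfold CUp
  simp_rw [CDown_eq h0]
  exact Jet.sum_gUp_mul h0 ε _

theorem sum_CUp_mul_CDown (h0 : (jet l p).detLam ≠ 0) :
    ∑ ε, CUp N l p ε * CDown N l p ε = ∑ a, torsionTrace ((jet l p).tor (N p)) a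
      * torsionTrace ((jet l p).tor (N p)) a := by
  simp_rw [CUp_eq h0, CDown_eq h0]
  exact sum_pairing' h0 _ _

theorem sum_CUp_mul_LamDown (h0 : (jet l p).detLam ≠ 0) (μ ν : Fin n) :
    ∑ ε, CUp N l p ε * LamDown N l p μ ε ν = pull (l p) (fun a b =>
      ∑ c, torsionTrace ((jet l p).tor (N p)) c * (jet l p).tor (N p) a c b) μ ν := by
  have h1 : ∀ ε, LamDown N l p μ ε ν
      = ∑ c, l p c ε * pull (l p) (fun a b => (jet l p).tor (N p) a c b) μ ν := fun ε => by
    rw [LamDown_eq h0]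
    simp only [pull, Finset.mul_sum]
    rw [Finset.sum_comm]
    exact Finset.sum_congr rfl fun b _ => Finset.sum_congr rfl fun i _ =>
      Finset.sum_congr rfl fun a _ => by ring
  simp_rw [CUp_eq h0, h1]
  rw [sum_pairing' (l := l p) h0]
  simp only [mul_pull, sum_pull]

/-- The frame components `λ_c^ε N^a_{ε;a}`. -/
def frameDivN (N l : TCoord n → Fin n → Fin n → ℝ) (p : TCoord n) (c : Fin n) : ℝ :=
  ∑ ε, dualFrame (l p) c ε * divN N p ε

theorem divN_eq (h0 : (jet l p).detLam ≠ 0) (ε : Fin n) :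
    divN N p ε = ∑ c, l p c ε * frameDivN N l p c :=
  (sum_frame_expand h0 _ ε).symm

theorem sum_CUp_mul_divN (h0 : (jet l p).detLam ≠ 0) :
    ∑ ε, CUp N l p ε * divN N p ε = ∑ a, torsionTrace ((jet l p).tor (N p)) a
      * frameDivN N l p a := by
  simp_rw [CUp_eq h0, divN_eq h0]
  exact sum_pairing' h0 _ _

theorem CDown_mul_divN (h0 : (jet l p).detLam ≠ 0) (μ ν : Fin n) :
    CDown N l p μ * divN N p ν = pull (l p) (fun a b => torsionTrace ((jet l p).tor (N p)) a
      * frameDivN N l p b) μ ν := by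
  rw [CDown_eq h0, divN_eq h0, pull_outer]

theorem sum_divN_mul (h0 : (jet l p).detLam ≠ 0) (μ ν : Fin n) :
    ∑ ε, divN N p ε * (Lam N l p ε ν μ - LamDownUp N l p μ ν ε) = pull (l p) (fun a b =>
      ∑ c, frameDivN N l p c
        * ((jet l p).tor (N p) c b a - (jet l p).tor (N p) a b c)) μ ν := by
  have h1 : ∀ ε, Lam N l p ε ν μ - LamDownUp N l p μ ν ε = ∑ c, dualFrame (l p) c ε
      * pull (l p) (fun a b => (jet l p).tor (N p) c b a - (jet l p).tor (N p) a b c) μ ν :=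
    fun ε => by
      rw [LamDownUp_eq h0, Lam, Jet.Lam_eq (N p) h0, ← Finset.sum_sub_distrib]
      refine Finset.sum_congr rfl fun c _ => ?_
      rw [pull_swap, ← pull_sub, mul_sub]
      rfl
  simp_rw [divN_eq h0, h1]
  rw [sum_pairing (l := l p) h0]
  simp only [mul_pull, sum_pull]

/-! ### Horizontal covariant derivatives in terms of frame components -/

theorem delta_eq_sum_frameDelta (h0 : (jet l p).detLam ≠ 0) (f : TCoord n → ℝ) (μ : Fin n) :
    delta N μ f p = ∑ a, l p a μ * frameDelta N l a f p :=
  (sum_frame_expand h0 (fun μ => delta N μ f p) μ).symm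

namespace SmoothCoframeOn

/-- The horizontal derivative of a covector given by frame components. -/
theorem delta_sum_coframe_mul (h : SmoothCoframeOn N l U) (hp : p ∈ U)
    {W : Fin n → TCoord n → ℝ} (hW : ∀ i, DifferentiableAt ℝ (W i) p) (ν μ : Fin n) :
    delta N μ (fun z => ∑ i, l z i ν * W i z) p
      = (∑ i, (jet l p).hor (N p) i ν μ * W i p) + ∑ i, l p i ν * delta N μ (W i) p := by
  have hl := fun i => h.differentiableAt hp (h.smooth_l i ν)
  rw [delta_sum fun i _ => (hl i).fun_mul (hW i), ← Finset.sum_add_distrib]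
  exact Finset.sum_congr rfl fun i _ => delta_mul (hl i) (hW i) μ

/-- The coframe is parallel, `δ_μ λ_{iν} = λ_{iε} Γ^ε_{νμ}`, so the connection term cancels the
derivative of the coframe. The same mechanism gives `covVec_eq` and `covCov3_eq`. -/
theorem covCovec_eq (h : SmoothCoframeOn N l U) (hp : p ∈ U) {W : Fin n → TCoord n → ℝ}
    (hW : ∀ i, DifferentiableAt ℝ (W i) p) (ν μ : Fin n) :
    covCovec N l (fun z ν => ∑ i, l z i ν * W i z) p ν μ
      = ∑ i, l p i ν * delta N μ (W i) p := by
  rw [covCovec, h.delta_sum_coframe_mul hp hW]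
  simp_rw [Gam_eq]
  rw [sum_pairing (h.det_ne_zero p hp)]
  simp only [mul_comm (W _ p)]
  ring

theorem covVec_eq (h : SmoothCoframeOn N l U) (hp : p ∈ U) {W : Fin n → TCoord n → ℝ}
    (hW : ∀ i, DifferentiableAt ℝ (W i) p) (α μ : Fin n) :
    covVec N l (fun z α => ∑ i, dualFrame (l z) i α * W i z) p α μ
      = ∑ i, dualFrame (l p) i α * delta N μ (W i) p := by
  have hu := fun i => h.differentiableAt hp (h.contDiffOn_dualFrame i α)
  rw [covVec, delta_sum fun i _ => (hu i).fun_mul (hW i)]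
  simp_rw [delta_mul (hu _) (hW _), h.delta_dualFrame hp]
  rw [Finset.sum_add_distrib]
  have : ∑ ε, (∑ i, dualFrame (l p) i ε * W i p) * Gam N l p α ε μ
      = ∑ i, (∑ c, (∑ β, dualFrame (l p) i β * (jet l p).hor (N p) c β μ)
        * dualFrame (l p) c α) * W i p := by
    have e : ∀ ε, (∑ i, dualFrame (l p) i ε * W i p) * Gam N l p α ε μ
        = ∑ i, dualFrame (l p) i ε * W i p * Gam N l p α ε μ := fun ε => Finset.sum_mul _ _ _
    simp_rw [e]
    rw [Finset.sum_comm]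
    refine Finset.sum_congr rfl fun i _ => ?_
    simp only [Gam_eq, Finset.sum_mul, Finset.mul_sum]
    rw [Finset.sum_comm]
    exact Finset.sum_congr rfl fun c _ => Finset.sum_congr rfl fun β _ => by ring
  rw [this]
  simp only [neg_mul, Finset.sum_neg_distrib]
  ring

theorem covCov3_eq (h : SmoothCoframeOn N l U) (hp : p ∈ U)
    {S : Fin n → Fin n → Fin n → TCoord n → ℝ} (hS : ∀ i a b, DifferentiableAt ℝ (S i a b) p)
    (μ ν α ε : Fin n) :
    covCov3 N l (fun z μ ν α => ∑ i, l z i μ * ∑ a, l z a ν * ∑ b, l z b α * S i a b z) p μ ν α ε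
      = ∑ i, l p i μ * ∑ a, l p a ν * ∑ b, l p b α * delta N ε (S i a b) p := by
  have hl := fun i ν => h.differentiableAt hp (h.smooth_l i ν)
  have h0 := h.det_ne_zero p hp
  have d1 : ∀ i a, DifferentiableAt ℝ (fun z => ∑ b, l z b α * S i a b z) p := fun i a =>
    DifferentiableAt.fun_sum fun b _ => (hl b α).fun_mul (hS i a b)
  have d2 : ∀ i, DifferentiableAt ℝ (fun z => ∑ a, l z a ν * ∑ b, l z b α * S i a b z) p := fun i =>
    DifferentiableAt.fun_sum fun a _ => (hl a ν).fun_mul (d1 i a)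
  -- `e2` and `e3` bring the factor carrying the contracted index `κ` outermost, the shape that
  -- `sum_pairing` needs against `Γ`.
  have e2 : ∀ κ, ∑ i, l p i μ * ∑ a, l p a κ * ∑ b, l p b α * S i a b p
      = ∑ a, l p a κ * ∑ i, l p i μ * ∑ b, l p b α * S i a b p := fun κ => by
    rw [sum_mul_sum_swap]
    refine Finset.sum_congr rfl fun a _ => ?_
    rw [Finset.mul_sum]
    exact Finset.sum_congr rfl fun i _ => by ring
  have e3 : ∀ κ, ∑ i, l p i μ * ∑ a, l p a ν * ∑ b, l p b κ * S i a b p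
      = ∑ b, l p b κ * ∑ i, l p i μ * ∑ a, l p a ν * S i a b p := fun κ => by
    simp only [Finset.mul_sum]
    calc _ = ∑ i, ∑ b, ∑ a, l p i μ * (l p a ν * (l p b κ * S i a b p)) :=
          Finset.sum_congr rfl fun i _ => Finset.sum_comm
      _ = _ := by
        rw [Finset.sum_comm]
        exact Finset.sum_congr rfl fun b _ => Finset.sum_congr rfl fun i _ =>
          Finset.sum_congr rfl fun a _ => by ring
  have g1 : ∑ κ, (∑ i, l p i κ * ∑ a, l p a ν * ∑ b, l p b α * S i a b p) * Gam N l p κ μ ε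
      = ∑ i, (jet l p).hor (N p) i μ ε * ∑ a, l p a ν * ∑ b, l p b α * S i a b p := by
    simp_rw [Gam_eq]
    rw [sum_pairing h0]
    exact Finset.sum_congr rfl fun i _ => mul_comm _ _
  have g2 : ∑ κ, (∑ i, l p i μ * ∑ a, l p a κ * ∑ b, l p b α * S i a b p) * Gam N l p κ ν ε
      = ∑ i, l p i μ * ∑ a, (jet l p).hor (N p) a ν ε * ∑ b, l p b α * S i a b p := by
    simp_rw [Gam_eq, e2]
    rw [sum_pairing h0, sum_mul_sum_swap]
    refine Finset.sum_congr rfl fun a _ => ?_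
    rw [Finset.sum_mul]
    exact Finset.sum_congr rfl fun i _ => by ring
  have g3 : ∑ κ, (∑ i, l p i μ * ∑ a, l p a ν * ∑ b, l p b κ * S i a b p) * Gam N l p κ α ε
      = ∑ i, l p i μ * ∑ a, l p a ν * ∑ b, (jet l p).hor (N p) b α ε * S i a b p := by
    simp_rw [Gam_eq, e3]
    rw [sum_pairing h0]
    simp only [Finset.mul_sum, Finset.sum_mul]
    rw [Finset.sum_comm]
    refine Finset.sum_congr rfl fun i _ => ?_
    rw [Finset.sum_comm]
    exact Finset.sum_congr rfl fun a _ => Finset.sum_congr rfl fun b _ => by ring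
  rw [covCov3, g1, g2, g3, h.delta_sum_coframe_mul hp d2]
  simp_rw [h.delta_sum_coframe_mul hp (d1 _), h.delta_sum_coframe_mul hp (hS _ _), mul_add,
    Finset.sum_add_distrib, mul_add, Finset.sum_add_distrib]
  ring

end SmoothCoframeOn

end FieldEquations
end EAP

/-! ### Covariant derivatives of the basic vector and of the torsion. -/

namespace EAP
namespace SmoothCoframeOn

variable {n : ℕ} {N l : TCoord n → Fin n → Fin n → ℝ} {U : Set (TCoord n)} {p : TCoord n}

theorem sum_covVec_CUp (h : SmoothCoframeOn N l U) (hp : p ∈ U) :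
    ∑ ε, covVec N l (CUp N l) p ε ε
      = ∑ c, frameDelta N l c (fun z => torsionTrace ((jet l z).tor (N z)) c) p := by
  have e : ∀ ε μ, covVec N l (CUp N l) p ε μ = covVec N l (fun z α => ∑ i, dualFrame (l z) i α
      * torsionTrace ((jet l z).tor (N z)) i) p ε μ := fun ε μ => by
    unfold covVec
    -- The derivative needs the frame formula near `p`, the connection term only at `p`.
    congr 1
    · refine delta_congr ?_ μ
      filter_upwards [h.isOpen.mem_nhds hp] with z hz using CUp_eq (h.det_ne_zero z hz) ε
    · simp_rw [CUp_eq (N := N) (l := l) (h.det_ne_zero p hp)]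
  simp_rw [e, h.covVec_eq hp fun i => h.differentiableAt hp (h.contDiffOn_torsionTrace i)]
  exact Finset.sum_comm

theorem delta_tor_antisymm (h : SmoothCoframeOn N l U) (hp : p ∈ U) (ν i a b : Fin n) :
    delta N ν (fun z => (jet l z).tor (N z) i a b) p
      = - delta N ν (fun z => (jet l z).tor (N z) i b a) p := by
  rw [← neg_one_mul, ← delta_const_mul (h.differentiableAt hp (h.contDiffOn_tor i b a))]
  congr 1
  ext z
  rw [neg_one_mul, ← Jet.tor_antisymm]

theorem delta_torsionTrace_eq (h : SmoothCoframeOn N l U) (hp : p ∈ U) (b μ : Fin n) :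
    delta N μ (fun z => torsionTrace ((jet l z).tor (N z)) b) p
      = ∑ i, delta N μ (fun z => (jet l z).tor (N z) i b i) p :=
  delta_sum (fun i _ => h.differentiableAt hp (h.contDiffOn_tor i b i)) μ

theorem covCovec_CDown (h : SmoothCoframeOn N l U) (hp : p ∈ U) (μ ν : Fin n) :
    covCovec N l (CDown N l) p ν μ = pull (l p) (fun a b =>
      frameDelta N l a (fun z => torsionTrace ((jet l z).tor (N z)) b) p) μ ν := by
  have e : covCovec N l (CDown N l) p ν μ = covCovec N l (fun z α => ∑ i, l z i α
      * torsionTrace ((jet l z).tor (N z)) i) p ν μ := by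
    unfold covCovec
    congr 1
    · refine delta_congr ?_ μ
      filter_upwards [h.isOpen.mem_nhds hp] with z hz using CDown_eq (h.det_ne_zero z hz) ν
    · simp_rw [CDown_eq (N := N) (l := l) (h.det_ne_zero p hp)]
  rw [e, h.covCovec_eq hp fun i => h.differentiableAt hp (h.contDiffOn_torsionTrace i), pull_swap]
  simp_rw [delta_eq_sum_frameDelta (N := N) (l := l) (h.det_ne_zero p hp)]
  rfl

theorem sum_gUp_mul_covCov3_LamDown (h : SmoothCoframeOn N l U) (hp : p ∈ U) (μ ν : Fin n) :
    ∑ ε, ∑ α, (jet l p).gUp ε α * covCov3 N l (LamDown N l) p μ ν α ε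
      = pull (l p) (fun a b => ∑ c,
        frameDelta N l c (fun z => (jet l z).tor (N z) a b c) p) μ ν := by
  have e : ∀ α ε, covCov3 N l (LamDown N l) p μ ν α ε = covCov3 N l (fun z μ ν α =>
      ∑ i, l z i μ * ∑ a, l z a ν * ∑ b, l z b α * (jet l z).tor (N z) i a b) p μ ν α ε :=
    fun α ε => by
      unfold covCov3
      congr 1
      · congr 1
        · congr 1
          · refine delta_congr ?_ ε
            filter_upwards [h.isOpen.mem_nhds hp] with z hz using
              LamDown_eq (h.det_ne_zero z hz) μ ν α
          · simp_rw [LamDown_eq (N := N) (l := l) (h.det_ne_zero p hp)]; rfl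
        · simp_rw [LamDown_eq (N := N) (l := l) (h.det_ne_zero p hp)]; rfl
      · simp_rw [LamDown_eq (N := N) (l := l) (h.det_ne_zero p hp)]; rfl
  have e2 : ∀ α ε, covCov3 N l (LamDown N l) p μ ν α ε = ∑ c, l p c α
      * pull (l p) (fun a b => delta N ε (fun z => (jet l z).tor (N z) a b c) p) μ ν :=
    fun α ε => by
      rw [e, h.covCov3_eq hp fun i a b => h.differentiableAt hp (h.contDiffOn_tor i a b)]
      simp only [pull, Finset.mul_sum]
      calc _ = ∑ i, ∑ b, ∑ a, l p i μ * (l p a ν * (l p b α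
              * delta N ε (fun z => (jet l z).tor (N z) i a b) p)) :=
            Finset.sum_congr rfl fun i _ => Finset.sum_comm
        _ = _ := by
          rw [Finset.sum_comm]
          exact Finset.sum_congr rfl fun b _ => Finset.sum_congr rfl fun i _ =>
            Finset.sum_congr rfl fun a _ => by ring
  have e3 : ∀ ε, ∑ α, (jet l p).gUp ε α * covCov3 N l (LamDown N l) p μ ν α ε
      = ∑ c, dualFrame (l p) c ε
        * pull (l p) (fun a b => delta N ε (fun z => (jet l z).tor (N z) a b c) p) μ ν :=
    fun ε => by
      simp_rw [e2]
      exact Jet.sum_gUp_mul (J := jet l p) (h.det_ne_zero p hp) ε _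
  simp_rw [e3]
  rw [Finset.sum_comm]
  simp only [mul_pull, sum_pull, frameDelta]

/-! ### The Bianchi identity -/

theorem delta_lineDeriv (h : SmoothCoframeOn N l U) (hp : p ∈ U) {f : TCoord n → ℝ}
    (hf : ContDiffOn ℝ ∞ f U) (κ : Fin n) (v : TCoord n) :
    delta N κ (fun z => lineDeriv ℝ f z v) p = fderiv ℝ (fderiv ℝ f) p (horVec N κ p) v := by
  have hU := h.isOpen.mem_nhds hp
  have hd : DifferentiableAt ℝ (fderiv ℝ f) p :=
    ((hf.fderiv_of_isOpen h.isOpen (m := ∞) (by simp)).contDiffAt hU).differentiableAt (by simp)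
  have e : (fun z => lineDeriv ℝ f z v) =ᶠ[nhds p] fun z => fderiv ℝ f z v := by
    filter_upwards [hU] with z hz using (h.differentiableAt hz hf).lineDeriv_eq_fderiv
  rw [delta_congr e, delta_eq_fderiv (hd.clm_apply (differentiableAt_const v)),
    fderiv_clm_apply hd (differentiableAt_const v)]
  simp

/-- The Hessian part is symmetric in `κ, ν`; only the derivative of the coefficients of `δ_ν` will
survive in the commutator. -/
theorem delta_delta (h : SmoothCoframeOn N l U) (hp : p ∈ U) {f : TCoord n → ℝ}
    (hf : ContDiffOn ℝ ∞ f U) (κ ν : Fin n) :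
    delta N κ (delta N ν f) p
      = fderiv ℝ (fderiv ℝ f) p (horVec N κ p) (horVec N ν p)
        - ∑ a, delta N κ (fun z => N z a ν) p * dY a f p := by
  have hX := h.differentiableAt hp (contDiffOn_lineDeriv hf h.isOpen (unitVec ν, 0))
  have hY := fun a => h.differentiableAt hp (contDiffOn_lineDeriv hf h.isOpen (0, unitVec a))
  have hN := fun a => h.differentiableAt hp (h.smooth_N a ν)
  have e : delta N ν f = fun z => lineDeriv ℝ f z (unitVec ν, 0)
      - ∑ a, N z a ν * lineDeriv ℝ f z (0, unitVec a) := rfl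
  rw [e, delta_sub hX (DifferentiableAt.fun_sum fun a _ => (hN a).fun_mul (hY a)),
    delta_sum fun a _ => (hN a).fun_mul (hY a)]
  simp_rw [delta_mul (hN _) (hY _), h.delta_lineDeriv hp hf]
  rw [horVec_eq N ν, map_sub, map_sum, Finset.sum_add_distrib]
  simp only [map_smul, smul_eq_mul, dY]
  ring

/-- The commutator of `δ_κ` and `δ_ν`. -/
theorem delta_delta_sub (h : SmoothCoframeOn N l U) (hp : p ∈ U) {f : TCoord n → ℝ}
    (hf : ContDiffOn ℝ ∞ f U) (κ ν : Fin n) :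
    delta N κ (delta N ν f) p - delta N ν (delta N κ f) p
      = -∑ a, curvN N p a ν κ * dY a f p := by
  have hs : IsSymmSndFDerivAt ℝ f p :=
    (hf.contDiffAt (h.isOpen.mem_nhds hp)).isSymmSndFDerivAt
      (by simpa using (WithTop.coe_le_coe.2 (le_top : (2 : ℕ∞) ≤ ⊤)))
  rw [h.delta_delta hp hf, h.delta_delta hp hf, hs.eq]
  simp only [curvN, sub_mul, Finset.sum_sub_distrib]
  ring

/-- The exterior derivative of the coframe, `δ_ν λ_{iμ} - δ_μ λ_{iν}`. -/
def _root_.EAP.coframeCurl (N l : TCoord n → Fin n → Fin n → ℝ) (i μ ν : Fin n)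
    (p : TCoord n) : ℝ :=
  (jet l p).hor (N p) i μ ν - (jet l p).hor (N p) i ν μ

theorem coframeCurl_eq (h : SmoothCoframeOn N l U) (hp : p ∈ U) (i μ ν : Fin n) :
    coframeCurl N l i μ ν p = pull (l p) ((jet l p).tor (N p) i) μ ν :=
  (pull_frameComp (h.det_ne_zero p hp) (fun μ ν => coframeCurl N l i μ ν p) μ ν).symm

theorem delta_coframeCurl (h : SmoothCoframeOn N l U) (hp : p ∈ U) (i μ ν κ : Fin n) :
    delta N κ (coframeCurl N l i μ ν) p
      = delta N κ (delta N ν fun z => l z i μ) p - delta N κ (delta N μ fun z => l z i ν) p :=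
  delta_sub (h.differentiableAt hp (h.contDiffOn_hor i μ ν))
    (h.differentiableAt hp (h.contDiffOn_hor i ν μ)) κ

/-- The six second derivatives group into three commutators, one for each of `λ_{iμ}`, `λ_{iν}`,
`λ_{iκ}`. Curvature is the obstruction to the exterior derivative squaring to zero. -/
theorem cyclic_delta_coframeCurl (h : SmoothCoframeOn N l U) (hp : p ∈ U) (i μ ν κ : Fin n) :
    delta N κ (coframeCurl N l i μ ν) p + delta N μ (coframeCurl N l i ν κ) p
        + delta N ν (coframeCurl N l i κ μ) p
      = -∑ a, ((jet l p).dy i μ a * curvN N p a ν κ + (jet l p).dy i ν a * curvN N p a κ μ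
        + (jet l p).dy i κ a * curvN N p a μ ν) := by
  have c1 := h.delta_delta_sub hp (h.smooth_l i μ) κ ν
  have c2 := h.delta_delta_sub hp (h.smooth_l i ν) μ κ
  have c3 := h.delta_delta_sub hp (h.smooth_l i κ) ν μ
  simp only [h.delta_coframeCurl hp, Finset.sum_add_distrib, jet]
  simp only [mul_comm (curvN N p _ _ _)] at c1 c2 c3
  linear_combination c1 + c2 + c3

theorem cyclicCR_eq_coframeCurl (h : SmoothCoframeOn N l U) (hp : p ∈ U) (μ ν : Fin n) :
    cyclicCR N l p μ ν = -∑ i, ∑ κ, dualFrame (l p) i κ *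
      (delta N κ (coframeCurl N l i μ ν) p + delta N μ (coframeCurl N l i ν κ) p
        + delta N ν (coframeCurl N l i κ μ) p) := by
  simp_rw [h.cyclic_delta_coframeCurl hp, mul_neg, Finset.sum_neg_distrib, neg_neg, cyclicCR]
  conv_rhs => rw [Finset.sum_comm]
  refine Finset.sum_congr rfl fun κ _ => ?_
  simp only [Jet.vert, Finset.sum_mul, Finset.mul_sum, ← Finset.sum_add_distrib]
  rw [Finset.sum_comm]
  refine Finset.sum_congr rfl fun i _ => Finset.sum_congr rfl fun a _ => ?_
  simp only [show (jet l p).up i κ = dualFrame (l p) i κ from rfl]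
  ring

/-- Second evaluation of the same derivative, by the product rule on frame components. Torsion
antisymmetry puts the two coframe derivatives in matching form, so that the cyclic sum assembles
them into curls. -/
theorem delta_coframeCurl_eq_pull (h : SmoothCoframeOn N l U) (hp : p ∈ U) (i μ ν κ : Fin n) :
    delta N κ (coframeCurl N l i μ ν) p
      = (∑ a, (jet l p).hor (N p) a μ κ * ∑ b, l p b ν * (jet l p).tor (N p) i a b)
        - (∑ a, (jet l p).hor (N p) a ν κ * ∑ b, l p b μ * (jet l p).tor (N p) i a b)
        + pull (l p) (fun a b => delta N κ (fun z => (jet l z).tor (N z) i a b) p) μ ν := by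
  have e : coframeCurl N l i μ ν =ᶠ[nhds p] fun z =>
      ∑ a, l z a μ * ∑ b, l z b ν * (jet l z).tor (N z) i a b := by
    filter_upwards [h.isOpen.mem_nhds hp] with z hz using h.coframeCurl_eq hz i μ ν
  have hT := fun a b => h.differentiableAt hp (h.contDiffOn_tor i a b)
  have hl := fun b => h.differentiableAt hp (h.smooth_l b ν)
  rw [delta_congr e, h.delta_sum_coframe_mul hp fun a =>
    DifferentiableAt.fun_sum fun b _ => (hl b).fun_mul (hT a b)]
  simp_rw [h.delta_sum_coframe_mul hp (hT _), mul_add, Finset.sum_add_distrib, pull]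
  have e2 : ∑ a, l p a μ * ∑ b, (jet l p).hor (N p) b ν κ * (jet l p).tor (N p) i a b
      = -∑ a, (jet l p).hor (N p) a ν κ * ∑ b, l p b μ * (jet l p).tor (N p) i a b := by
    simp only [Finset.mul_sum]
    rw [Finset.sum_comm, ← Finset.sum_neg_distrib]
    refine Finset.sum_congr rfl fun a _ => ?_
    rw [← Finset.sum_neg_distrib]
    refine Finset.sum_congr rfl fun b _ => ?_
    rw [(jet l p).tor_antisymm (N p) i a b]
    ring
  rw [e2]
  ring

theorem cyclic_delta_coframeCurl_eq_pull (h : SmoothCoframeOn N l U) (hp : p ∈ U)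
    (i μ ν κ : Fin n) :
    delta N κ (coframeCurl N l i μ ν) p + delta N μ (coframeCurl N l i ν κ) p
        + delta N ν (coframeCurl N l i κ μ) p
      = (∑ a, coframeCurl N l a μ κ p * ∑ b, l p b ν * (jet l p).tor (N p) i a b)
        + (∑ a, coframeCurl N l a κ ν p * ∑ b, l p b μ * (jet l p).tor (N p) i a b)
        + (∑ a, coframeCurl N l a ν μ p * ∑ b, l p b κ * (jet l p).tor (N p) i a b)
        + pull (l p) (fun a b => delta N κ (fun z => (jet l z).tor (N z) i a b) p) μ ν
        + pull (l p) (fun a b => delta N μ (fun z => (jet l z).tor (N z) i a b) p) ν κ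
        + pull (l p) (fun a b => delta N ν (fun z => (jet l z).tor (N z) i a b) p) κ μ := by
  simp only [h.delta_coframeCurl_eq_pull hp, coframeCurl, sub_mul, Finset.sum_sub_distrib]
  ring

/-- The contracted Bianchi identity. -/
theorem cyclicCR_eq (h : SmoothCoframeOn N l U) (hp : p ∈ U) (μ ν : Fin n) :
    cyclicCR N l p μ ν = pull (l p) (fun a b =>
      frameDelta N l b (fun z => torsionTrace ((jet l z).tor (N z)) a) p
      - frameDelta N l a (fun z => torsionTrace ((jet l z).tor (N z)) b) p
      - (∑ c, frameDelta N l c (fun z => (jet l z).tor (N z) c a b) p)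
      - ∑ c, torsionTrace ((jet l p).tor (N p)) c * (jet l p).tor (N p) c b a) μ ν := by
  have h0 := h.det_ne_zero p hp
  set T := (jet l p).tor (N p) with hT
  -- After contraction both terms reduce, up to sign, to the same product of two torsions with `i`
  -- and `a` exchanged, so they cancel.
  have q12 : ∑ i, ∑ κ, dualFrame (l p) i κ *
      ((∑ a, coframeCurl N l a μ κ p * ∑ b, l p b ν * T i a b)
        + ∑ a, coframeCurl N l a κ ν p * ∑ b, l p b μ * T i a b) = 0 := by
    have r : ∀ i μ ν, ∑ κ, dualFrame (l p) i κ *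
        (∑ a, coframeCurl N l a κ μ p * ∑ b, l p b ν * T i a b)
        = ∑ a, (∑ b, l p b μ * T a i b) * ∑ b, l p b ν * T i a b := fun i μ ν => by
      rw [sum_mul_sum_swap]
      refine Finset.sum_congr rfl fun a _ => ?_
      rw [← sum_dualFrame_coframe h0 (fun i => ∑ b, l p b μ * T a i b) i, Finset.sum_mul]
      refine Finset.sum_congr rfl fun κ _ => ?_
      rw [h.coframeCurl_eq hp, pull, mul_assoc]
    have r' : ∀ a μ κ, coframeCurl N l a μ κ p = - coframeCurl N l a κ μ p := fun a μ κ => by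
      simp only [coframeCurl, neg_sub]
    simp_rw [mul_add, r' _ μ, neg_mul, Finset.sum_neg_distrib, mul_neg, Finset.sum_add_distrib,
      Finset.sum_neg_distrib, r]
    rw [Finset.sum_comm, neg_add_eq_zero]
    exact Finset.sum_congr rfl fun a _ => Finset.sum_congr rfl fun i _ => mul_comm _ _
  have q3 : ∑ i, ∑ κ, dualFrame (l p) i κ *
      (∑ a, coframeCurl N l a ν μ p * ∑ b, l p b κ * T i a b)
      = pull (l p) (fun a b => ∑ c, torsionTrace T c * T c b a) μ ν := by
    have r : ∀ i, ∑ κ, dualFrame (l p) i κ *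
        (∑ a, coframeCurl N l a ν μ p * ∑ b, l p b κ * T i a b)
        = ∑ a, coframeCurl N l a ν μ p * T i a i := fun i => by
      rw [sum_mul_sum_swap]
      refine Finset.sum_congr rfl fun a _ => ?_
      rw [← sum_dualFrame_coframe h0 (fun b => T i a b) i, Finset.mul_sum]
      exact Finset.sum_congr rfl fun κ _ => by ring
    simp_rw [r]
    rw [Finset.sum_comm, pull_swap, ← sum_pull]
    refine Finset.sum_congr rfl fun c _ => ?_
    rw [← Finset.mul_sum, h.coframeCurl_eq hp, ← mul_pull, mul_comm]
    rfl
  have q4 : ∑ i, ∑ κ, dualFrame (l p) i κ *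
      pull (l p) (fun a b => delta N κ (fun z => (jet l z).tor (N z) i a b) p) μ ν
      = pull (l p) (fun a b => ∑ c, frameDelta N l c (fun z => (jet l z).tor (N z) c a b) p) μ ν := by
    simp only [mul_pull, sum_pull, frameDelta]
  have q5 : ∀ μ ν, ∑ i, ∑ κ, dualFrame (l p) i κ *
      pull (l p) (fun a b => delta N μ (fun z => (jet l z).tor (N z) i a b) p) ν κ
      = pull (l p) (fun a b =>
        frameDelta N l a (fun z => torsionTrace ((jet l z).tor (N z)) b) p) μ ν := fun μ ν => by
    have r : ∀ i, ∑ κ, dualFrame (l p) i κ *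
        pull (l p) (fun a b => delta N μ (fun z => (jet l z).tor (N z) i a b) p) ν κ
        = ∑ a, l p a ν * delta N μ (fun z => (jet l z).tor (N z) i a i) p := fun i => by
      simp_rw [pull_swap (l p) _ ν]
      exact sum_dualFrame_coframe h0
        (fun b => ∑ a, l p a ν * delta N μ (fun z => (jet l z).tor (N z) i a b) p) i
    simp_rw [r]
    rw [Finset.sum_comm, pull_swap]
    refine Finset.sum_congr rfl fun b _ => ?_
    rw [← Finset.mul_sum, ← h.delta_torsionTrace_eq hp, delta_eq_sum_frameDelta h0]
  -- This is `q5` with `μ, ν` exchanged; the sign comes from the antisymmetry of the torsion.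
  have q6 : ∑ i, ∑ κ, dualFrame (l p) i κ *
      pull (l p) (fun a b => delta N ν (fun z => (jet l z).tor (N z) i a b) p) κ μ
      = - pull (l p) (fun a b =>
        frameDelta N l b (fun z => torsionTrace ((jet l z).tor (N z)) a) p) μ ν := by
    rw [pull_swap, ← q5]
    simp_rw [pull_swap (l p) _ _ μ]
    rw [← Finset.sum_neg_distrib]
    refine Finset.sum_congr rfl fun i _ => ?_
    rw [← Finset.sum_neg_distrib]
    refine Finset.sum_congr rfl fun κ _ => ?_
    rw [← mul_neg, ← neg_one_mul, mul_pull (l p) (-1)]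
    congr 1
    refine congrArg (fun X => pull (l p) X μ κ) ?_
    ext a b
    rw [h.delta_tor_antisymm hp, neg_one_mul]
  rw [h.cyclicCR_eq_coframeCurl hp]
  simp_rw [h.cyclic_delta_coframeCurl_eq_pull hp]
  have split : ∀ A B C D E F : Fin n → Fin n → ℝ,
      ∑ i, ∑ κ, dualFrame (l p) i κ * (A i κ + B i κ + C i κ + D i κ + E i κ + F i κ)
      = (∑ i, ∑ κ, dualFrame (l p) i κ * (A i κ + B i κ))
        + (∑ i, ∑ κ, dualFrame (l p) i κ * C i κ) + (∑ i, ∑ κ, dualFrame (l p) i κ * D i κ)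
        + (∑ i, ∑ κ, dualFrame (l p) i κ * E i κ) + ∑ i, ∑ κ, dualFrame (l p) i κ * F i κ := by
    intro A B C D E F
    simp only [mul_add, Finset.sum_add_distrib]
  rw [split, q12, q3, q4, q5, q6, ← pull_sub, ← pull_sub, ← pull_sub]
  ring

end SmoothCoframeOn
end EAP

namespace EAP
namespace SmoothCoframeOn

variable {n : ℕ} {N l : TCoord n → Fin n → Fin n → ℝ} {U : Set (TCoord n)} {p : TCoord n}

/-! ### The field equations in the frame -/

theorem superpotential_eq (T : Fin n → Fin n → Fin n → ℝ) (j a c : Fin n) :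
    superpotential T j a c = 2 * T a j c - 2 * (if c = j then torsionTrace T a else 0)
      - 2 * T c j a + 2 * (if a = j then torsionTrace T c else 0) := by
  simp only [superpotential, momentum]
  ring

theorem sum_mul_superpotential (T : Fin n → Fin n → Fin n → ℝ) (f : Fin n → ℝ) (j a : Fin n) :
    ∑ c, f c * superpotential T j a c = 2 * (∑ c, f c * T a j c) - 2 * (torsionTrace T a * f j)
      - 2 * (∑ c, f c * T c j a)
      + 2 * ((if a = j then 1 else 0) * ∑ c, torsionTrace T c * f c) := by
  have e : ∀ c, f c * superpotential T j a c = 2 * (f c * T a j c)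
      - 2 * (if c = j then torsionTrace T a * f c else 0) - 2 * (f c * T c j a)
      + 2 * ((if a = j then 1 else 0) * (torsionTrace T c * f c)) := fun c => by
    rw [superpotential_eq]
    split_ifs <;> ring
  simp only [e, Finset.sum_add_distrib, Finset.sum_sub_distrib, ← Finset.mul_sum,
    Finset.sum_ite_eq', Finset.mem_univ, if_true]

theorem sum_tor_mul_superpotential {T : Fin n → Fin n → Fin n → ℝ}
    (hT : ∀ i a b, T i a b = - T i b a) (j a : Fin n) :
    ∑ i, ∑ b, T i j b * superpotential T i a b
      = 2 * (∑ i, ∑ b, T i j b * T a i b) - 2 * (torsionTrace T a * torsionTrace T j)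
        + 2 * (∑ c, ∑ e, T c e a * T e c j) - 2 * ∑ c, torsionTrace T c * T a c j := by
  have e1 : ∑ i, ∑ b, T i j b * T b i a = -∑ c, ∑ e, T c e a * T e c j := by
    rw [Finset.sum_comm]
    simp_rw [hT _ j _, neg_mul, Finset.sum_neg_distrib, mul_comm (T _ _ j)]
  have e2 : ∑ c, torsionTrace T c * T a j c = -∑ c, torsionTrace T c * T a c j := by
    simp_rw [hT a j _, mul_neg, Finset.sum_neg_distrib]
  simp only [sum_mul_superpotential, Finset.sum_add_distrib, Finset.sum_sub_distrib,
    ← Finset.mul_sum, e1, ite_mul, one_mul, zero_mul, Finset.sum_ite_eq, Finset.mem_univ, if_true,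
    e2]
  simp only [torsionTrace]
  ring

/-- Subtracting `sum_tor_mul_superpotential` from this cancels all terms except `-2 * frameH T a j`,
the origin of `-2H_{μν}`. -/
theorem sum_tor_mul_momentum {T : Fin n → Fin n → Fin n → ℝ} (j a : Fin n) :
    ∑ b, ∑ c, T a b c * momentum T j b c
      = 2 * (∑ i, ∑ b, T i j b * T a i b) - 2 * ∑ c, torsionTrace T c * T a c j := by
  simp only [momentum, mul_sub, Finset.sum_sub_distrib, mul_ite, mul_zero, Finset.sum_ite_eq',
    Finset.mem_univ, if_true, Finset.mul_sum]
  congr 1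
  · exact Finset.sum_congr rfl fun _ _ => Finset.sum_congr rfl fun _ _ => by ring
  · exact Finset.sum_congr rfl fun _ _ => by ring

theorem sum_frameDelta_superpotential (h : SmoothCoframeOn N l U) (hp : p ∈ U) (j a : Fin n) :
    ∑ c, frameDelta N l c (fun z => superpotential ((jet l z).tor (N z)) j a c) p
      = 2 * (∑ c, frameDelta N l c (fun z => (jet l z).tor (N z) a j c) p)
        - 2 * frameDelta N l j (fun z => torsionTrace ((jet l z).tor (N z)) a) p
        - 2 * (∑ c, frameDelta N l c (fun z => (jet l z).tor (N z) c j a) p)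
        + 2 * ((if a = j then 1 else 0)
          * ∑ c, frameDelta N l c (fun z => torsionTrace ((jet l z).tor (N z)) c) p) := by
  have hT := fun i a b => h.differentiableAt hp (h.contDiffOn_tor i a b)
  have hc := fun a => h.differentiableAt hp (h.contDiffOn_torsionTrace a)
  have e : ∀ c μ, delta N μ (fun z => superpotential ((jet l z).tor (N z)) j a c) p
      = 2 * delta N μ (fun z => (jet l z).tor (N z) a j c) p
        - 2 * ((if c = j then 1 else 0)
            * delta N μ (fun z => torsionTrace ((jet l z).tor (N z)) a) p)
        - (2 * delta N μ (fun z => (jet l z).tor (N z) c j a) p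
          - 2 * ((if a = j then 1 else 0)
            * delta N μ (fun z => torsionTrace ((jet l z).tor (N z)) c) p)) := fun c μ => by
    have m : ∀ b c, DifferentiableAt ℝ (fun z => (2 * (if c = j then 1 else 0 : ℝ))
        * torsionTrace ((jet l z).tor (N z)) b) p := fun b c => (hc b).const_mul _
    have s : (fun z => superpotential ((jet l z).tor (N z)) j a c) = fun z =>
        (2 * (jet l z).tor (N z) a j c - (2 * (if c = j then 1 else 0 : ℝ))
          * torsionTrace ((jet l z).tor (N z)) a) -
        (2 * (jet l z).tor (N z) c j a - (2 * (if a = j then 1 else 0 : ℝ))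
          * torsionTrace ((jet l z).tor (N z)) c) := by
      ext z
      simp only [superpotential, momentum]
      split_ifs <;> ring
    rw [s, delta_sub (((hT a j c).const_mul 2).fun_sub (m a c))
      (((hT c j a).const_mul 2).fun_sub (m c a)),
      delta_sub ((hT a j c).const_mul 2) (m a c), delta_sub ((hT c j a).const_mul 2) (m c a),
      delta_const_mul (hT a j c), delta_const_mul (hT c j a), delta_const_mul (hc a),
      delta_const_mul (hc c)]
    ring
  have e2 : ∀ c, frameDelta N l c (fun z => superpotential ((jet l z).tor (N z)) j a c) p
      = 2 * frameDelta N l c (fun z => (jet l z).tor (N z) a j c) p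
        - 2 * ((if c = j then 1 else 0)
            * frameDelta N l c (fun z => torsionTrace ((jet l z).tor (N z)) a) p)
        - (2 * frameDelta N l c (fun z => (jet l z).tor (N z) c j a) p
          - 2 * ((if a = j then 1 else 0)
            * frameDelta N l c (fun z => torsionTrace ((jet l z).tor (N z)) c) p)) := fun c => by
    simp only [frameDelta, e, Finset.mul_sum, ← Finset.sum_sub_distrib]
    exact Finset.sum_congr rfl fun γ _ => by ring
  simp only [e2, Finset.sum_sub_distrib, ← Finset.mul_sum, ite_mul, one_mul, zero_mul,
    Finset.sum_ite_eq', Finset.mem_univ, if_true]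
  split_ifs
  · ring
  · rw [Finset.sum_const_zero]
    ring

/-- The Euler–Lagrange expression in the frame. -/
theorem sum_coframe_mul_eulerLagrange (h : SmoothCoframeOn N l U) (hp : p ∈ U) (a j : Fin n) :
    ∑ β, l p a β * eulerLagrange N l p j β
      = (jet l p).detLam * (
        (if a = j then ∑ c, frameH ((jet l p).tor (N p)) c c else 0)
        - (∑ i, ∑ b, (jet l p).tor (N p) i j b * superpotential ((jet l p).tor (N p)) i a b)
        - (∑ c, frameDelta N l c (fun z => superpotential ((jet l z).tor (N z)) j a c) p)
        + (∑ c, torsionTrace ((jet l p).tor (N p)) c * superpotential ((jet l p).tor (N p)) j a c)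
        + (∑ b, ∑ c, (jet l p).tor (N p) a b c * momentum ((jet l p).tor (N p)) j b c)
        + ∑ c, frameDivN N l p c * superpotential ((jet l p).tor (N p)) j a c) := by
  have h0 : (jet l p).detLam ≠ 0 := h.det_ne_zero p hp
  have hn : ∑ β, l p a β * ∑ γ, divN N p γ * (jet l p).conjMomentum (N p) j β γ
      = (jet l p).detLam * ∑ c, frameDivN N l p c
        * superpotential ((jet l p).tor (N p)) j a c := by
    have e : ∀ γ, ∑ β, l p a β * (divN N p γ * (jet l p).conjMomentum (N p) j β γ)
        = (jet l p).detLam * (divN N p γ * ∑ c, dualFrame (l p) c γ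
          * superpotential ((jet l p).tor (N p)) j a c) := fun γ => by
      rw [← sum_coframe_dualFrame (l := l p) h0 (fun b => ∑ c, dualFrame (l p) c γ
          * superpotential ((jet l p).tor (N p)) j b c) a, Finset.mul_sum, Finset.mul_sum]
      refine Finset.sum_congr rfl fun β _ => ?_
      rw [Jet.conjMomentum]
      change l p a β * (divN N p γ * ((jet l p).detLam * ∑ b, dualFrame (l p) b β
        * ∑ c, dualFrame (l p) c γ * superpotential ((jet l p).tor (N p)) j b c)) = _
      ring
    rw [sum_mul_sum_swap]
    simp_rw [e]
    rw [← Finset.mul_sum, sum_mul_sum_swap]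
    congr 1
    refine Finset.sum_congr rfl fun c _ => ?_
    rw [frameDivN, Finset.sum_mul]
    exact Finset.sum_congr rfl fun γ _ => by ring
  -- The term left by differentiating `λ_b^β` contains unantisymmetrized derivatives of the coframe;
  -- against the antisymmetric superpotential only their torsion matters.
  have hm : ∑ b, ∑ c, (jet l p).tor (N p) a b c * momentum ((jet l p).tor (N p)) j b c
      = ∑ b, ∑ c, frameComp (l p) ((jet l p).hor (N p) a) b c
        * superpotential ((jet l p).tor (N p)) j b c := by
    simp only [Jet.tor, frameTorsion_eq]
    exact sum_antisymmetrize_mul _ _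
  simp only [h.eulerLagrange_eq hp, mul_add, mul_sub, Finset.sum_add_distrib,
    Finset.sum_sub_distrib]
  rw [hn, hm, h.sum_coframe_mul_delta_conjMomentum hp]
  have := Jet.sum_coframe_mul_partialVal (N := N p) h0 a j
  simp only [jet] at this ⊢
  rw [this]
  ring

/-- Once the Bianchi identity replaces the curvature terms, its `-2` times the frame derivative `a`
of the trace `b` cancels `2C_{ν|μ}`. What remains agrees term by term with the Euler–Lagrange
expression. -/
theorem fieldE_eq_pull (h : SmoothCoframeOn N l U) (hp : p ∈ U) (μ ν : Fin n) :
    fieldE N l p μ ν = pull (l p) (fun a j =>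
      (jet l p).detLam⁻¹ * ∑ β, l p a β * eulerLagrange N l p j β) μ ν := by
  have h0 : (jet l p).detLam ≠ 0 := h.det_ne_zero p hp
  have hg : ∀ k : ℝ, (jet l p).gDown μ ν * k
      = pull (l p) (fun a b => k * if a = b then 1 else 0) μ ν := fun k => by
    rw [← mul_pull, ← pull_one, mul_comm]; rfl
  have hH : (jet l p).HTensor (N p) μ ν = pull (l p) (frameH ((jet l p).tor (N p))) μ ν :=
    Jet.HTensor_eq (N p) h0 μ ν
  rw [fieldE, mul_assoc 2, mul_assoc 2, hg, hg, hg, hH, CDown_mul_divN h0, sum_divN_mul h0,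
    h.sum_gUp_mul_covCov3_LamDown hp, h.covCovec_CDown hp, sum_CUp_mul_LamDown h0,
    h.cyclicCR_eq hp, CDown_eq h0, CDown_eq h0, pull_outer, h.sum_covVec_CUp hp,
    sum_CUp_mul_CDown h0, sum_CUp_mul_divN h0, Jet.HScalar_eq (N p) h0]
  simp only [mul_pull, pull_sub, pull_add]
  congr 1
  ext a j
  rw [h.sum_coframe_mul_eulerLagrange hp, inv_mul_cancel_left₀ h0]
  have hA := (jet l p).tor_antisymm (N p)
  rw [h.sum_frameDelta_superpotential hp, sum_mul_superpotential, sum_mul_superpotential,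
    sum_tor_mul_superpotential hA, sum_tor_mul_momentum]
  simp only [frameH, ite_mul, mul_ite, mul_one, mul_zero, one_mul, zero_mul]
  simp only [mul_sub, Finset.sum_sub_distrib]
  -- `e1` and `e2` fix one order of the antisymmetric torsion indices, so that equal terms are
  -- recognized as such.
  have e1 : ∑ c, frameDelta N l c (fun z => (jet l z).tor (N z) c a j) p
      = -∑ c, frameDelta N l c (fun z => (jet l z).tor (N z) c j a) p := by
    simp only [frameDelta, h.delta_tor_antisymm hp _ _ a j, mul_neg, Finset.sum_neg_distrib]
  have e2 : ∑ c, torsionTrace ((jet l p).tor (N p)) c * (jet l p).tor (N p) a j c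
      = -∑ c, torsionTrace ((jet l p).tor (N p)) c * (jet l p).tor (N p) a c j := by
    simp only [hA a j, mul_neg, Finset.sum_neg_distrib]
  rw [e1, e2]
  split_ifs <;> ring

theorem fieldE_eq (h : SmoothCoframeOn N l U) (hp : p ∈ U) (μ ν : Fin n) :
    fieldE N l p μ ν = ∑ β, (jet l p).gDown μ β *
      ((jet l p).detLam⁻¹ * ∑ j, eulerLagrange N l p j β * l p j ν) := by
  have e : ∀ β, (jet l p).gDown μ β * ((jet l p).detLam⁻¹ * ∑ j, eulerLagrange N l p j β * l p j ν)
      = ∑ a, ∑ j, l p a μ * (l p j ν * ((jet l p).detLam⁻¹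
        * (l p a β * eulerLagrange N l p j β))) := fun β => by
    rw [Jet.gDown, Finset.sum_mul]
    refine Finset.sum_congr rfl fun a _ => ?_
    simp only [Finset.mul_sum]
    refine Finset.sum_congr rfl fun j _ => ?_
    simp only [jet]
    ring
  rw [h.fieldE_eq_pull hp]
  simp_rw [e]
  simp only [pull, Finset.mul_sum]
  conv_rhs => rw [Finset.sum_comm]
  exact Finset.sum_congr rfl fun a _ => Finset.sum_comm

theorem eulerLagrange_eq_zero_iff (h : SmoothCoframeOn N l U) (hp : p ∈ U) :
    (∀ j β, eulerLagrange N l p j β = 0) ↔ ∀ μ ν, fieldE N l p μ ν = 0 := by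
  have h0 := h.det_ne_zero p hp
  constructor
  · intro hE μ ν
    simp [h.fieldE_eq hp, hE]
  · intro hF j β
    -- A vanishing tensor has vanishing frame components, and `|λ|` is nonzero; expanding in the
    -- frame then recovers each single component.
    have hX : ∀ a j, ∑ β, l p a β * eulerLagrange N l p j β = 0 := fun a j => by
      have := frameComp_pull h0 (fun a j =>
        (jet l p).detLam⁻¹ * ∑ β, l p a β * eulerLagrange N l p j β) a j
      have hz : pull (l p) (fun a j => (jet l p).detLam⁻¹
          * ∑ β, l p a β * eulerLagrange N l p j β) = 0 := by
        ext μ ν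
        rw [← h.fieldE_eq_pull hp, hF]; rfl
      rw [hz] at this
      simp only [frameComp, Pi.zero_apply, mul_zero, Finset.sum_const_zero] at this
      exact (mul_eq_zero.1 this.symm).resolve_left (inv_ne_zero h0)
    rw [← sum_frame_expand_up h0 (fun β => eulerLagrange N l p j β) β]
    simp [hX]

end SmoothCoframeOn

/-! ### From charts of `M` to local coframes. -/

theorem isOpen_coordDomain {n : ℕ} {M : Type*} [TopologicalSpace M]
    (e : OpenPartialHomeomorph M (Coord n)) (slit : Prop) : IsOpen (coordDomain e slit) := by
  by_cases hs : slit
  · have : coordDomain e slit = Prod.fst ⁻¹' e.target ∩ {p | p.2 ≠ 0} := by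
      ext; simp [coordDomain, hs]
    rw [this]
    exact (e.open_target.preimage continuous_fst).inter
      (isOpen_ne_fun continuous_snd continuous_const)
  · have : coordDomain e slit = Prod.fst ⁻¹' e.target := by
      ext; simp [coordDomain, hs]
    rw [this]
    exact e.open_target.preimage continuous_fst

/-- The `λ_{iβ}` are the dual frame of the matrix `(λ_i^α)`, so the Cramer argument applies with the
two roles exchanged; their matrix is an inverse transpose, hence invertible. -/
theorem EAPSpace.smoothCoframeOn {n : ℕ} {M : Type*} [TopologicalSpace M]
    [ChartedSpace (Coord n) M] {slit : Prop} (S : EAPSpace n M slit)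
    {e : OpenPartialHomeomorph M (Coord n)} (he : e ∈ IsManifold.maximalAtlas (𝓡 n) ∞ M) :
    SmoothCoframeOn (S.nCoeff e) (S.hCov e) (coordDomain e slit) := by
  have hdet : ∀ p ∈ coordDomain e slit,
      (Matrix.of fun i α => (S.hor i).comp e p α).det ≠ 0 := fun p hp => by
    have := Matrix.linearIndependent_rows_iff_isUnit.1 (S.hor_independent e he p hp)
    exact ((Matrix.isUnit_iff_isUnit_det _).1 this).ne_zero
  refine ⟨isOpen_coordDomain e slit, S.N.smooth e he, fun i β p hp => ?_, fun p hp => ?_⟩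
  · have hc : ContDiffOn ℝ ∞ (fun p i α => (S.hor i).comp e p α) (coordDomain e slit) :=
      contDiffOn_pi.2 fun i => contDiffOn_pi.2 fun α => (S.hor i).smooth e he α
    exact (contDiffAt_dualFrame (hdet p hp) i β).comp_contDiffWithinAt p (hc p hp)
  · have : Matrix.of (S.hCov e p) = (Matrix.of fun i α => (S.hor i).comp e p α)⁻¹.transpose := rfl
    rw [this, Matrix.det_transpose]
    exact (Matrix.isUnit_nonsing_inv_det _ (isUnit_iff_ne_zero.2 (hdet p hp))).ne_zero

end EAP
end

theorem mainTheorem1 {n : ℕ} {M : Type*} [TopologicalSpace M] [T2Space M] [ParacompactSpace M]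
    [ChartedSpace (EAP.Coord n) M] [IsManifold (𝓡 n) ∞ M] {slit : Prop}
    (S : EAP.EAPSpace n M slit) (e : OpenPartialHomeomorph M (EAP.Coord n))
    (he : e ∈ IsManifold.maximalAtlas (𝓡 n) ∞ M)
    (p : EAP.TCoord n) (hp : p ∈ EAP.coordDomain e slit) :
    (∀ μ ν : Fin n, EAP.fieldE (S.nCoeff e) (S.hCov e) p μ ν =
      ∑ β, (EAP.jet (S.hCov e) p).gDown μ β *
        ((EAP.jet (S.hCov e) p).detLam⁻¹ *
          ∑ j, EAP.eulerLagrange (S.nCoeff e) (S.hCov e) p j β * S.hCov e p j ν)) ∧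
    ((∀ j β : Fin n, EAP.eulerLagrange (S.nCoeff e) (S.hCov e) p j β = 0) ↔
      ∀ μ ν : Fin n, EAP.fieldE (S.nCoeff e) (S.hCov e) p μ ν = 0) :=
  ⟨(S.smoothCoframeOn he).fieldE_eq hp, (S.smoothCoframeOn he).eulerLagrange_eq_zero_iff hp⟩
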